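/- Let $\mathcal S=\{1,\dots,S\}$ be a finite set of local states, $\Delta\subset\mathbb R^{\mathcal S}$ the probability simplex and $\|\cdot\|$ the $1$-norm on $\mathbb R^{\mathcal S}$. For $k,s\in\mathcal S$ let $Q_{ks}:\mathbb R^{\mathcal S}\to\mathbb R$ be locally Lipschitz functions with $Q_{ks}(\varphi)\ge 0$ whenever $k\ne s$ and all coordinates of $\varphi$ are nonnegative, and $Q_{ss}=-\sum_{k\ne s}Q_{ks}$; write $Q=(Q_{ks})$ for the resulting matrix-valued function. **Graph.** For every $N$ let $w^N_{ij}$ and $b^N_{ij}$ ($1\le i<j\le N$) be mutually independent random variables; the $w_{ij}^N$ have a common law on $[0,\infty)$, not depending on $N$, with mean $\mu\in(0,\infty)$ and finite variance, and $b^N_{ij}\in\{0,1\}$ with $\mathbb P(b^N_{ij}=1)=p^N\in[0,1]$. Put $a^N_{ij}=a^N_{ji}=w^N_{ij}b^N_{ij}$ for $i<j$, $a^N_{ii}=0$, and let $\langle d\rangle=(N-1)p^N\mu$ be the average weighted degree. $G^N$ denotes the weighted graph $(a_{ij}^N)$. **Process.** Conditionally on $G^N$, the states of the $N$ vertices form a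 continuous-time Markov chain on $\mathcal S^N$ with càdlàg paths, in which vertex $i$ jumps from state $s$ to state $k\ne s$ at rate $Q_{ks}(\phi^N_i(t))$, where $$\phi_i^N(t)=\frac1{\langle d\rangle}\sum_{j=1}^N a^N_{ij}\,\xi_j^N(t)$$ and $\xi_j^N(t)=(\xi^N_{s,j}(t))_{s\in\mathcal S}$ is the indicator vector of the state of vertex $j$ at time $t$. The initial states may be random and may depend on $G^N$. Put $x^N(t)=\frac1N\sum_{i=1}^N\xi_i^N(t)$. **NIMFA.** Let $z_1^N,\dots,z_N^N$ be the solution on $[0,\infty)$ of $$\dot z_i^N(t)=Q(\rho_i^N(t))\,z_i^N(t),\qquad \rho_i^N(t)=\frac1{\langle d\rangle}\sum_{j=1}^N a_{ij}^N z_j^N(t),\qquad z_i^N(0)\in\Delta,$$ with possibly random initial values, and put $y^N(t)=\frac1N\sum_{i=1}^N z_i^N(t)$. **Homogeneous mean field.** Let $u$ be the solution on $[0,\infty)$ of $\dot u(t)=Q(u(t))u(t)$ with $u(0)\in\Delta$. Assume that $x^N(0)\to u(0)$ and $y^N(0)\to u(0)$ in probability as $N\to\infty$, and that one of the following two pairs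 of conditions holds: * (A1) every $Q_{ks}$ is globally Lipschitz on $\mathbb R^{\mathcal S}$, and (A2) there are constants $c,\epsilon>0$ with $\langle d\rangle\ge cN^{1/2+\epsilon}$ for all sufficiently large $N$; or * (B1) $p^N=1$ for all $N$, and (B2) $\mathbb E\exp(\theta w^N_{12})<\infty$ for some $\theta>0$. Then for every $T>0$, as $N\to\infty$, $$\sup_{0\le t\le T}\|x^N(t)-u(t)\|\to 0\quad\text{and}\quad \sup_{0\le t\le T}\|y^N(t)-u(t)\|\to 0\quad\text{in probability.}$$ -/

import Mathlib

open MeasureTheory ProbabilityTheory Filter Topology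
open scoped ENNReal Matrix

noncomputable section

namespace MeanField

/-- Unordered pairs of distinct vertices, written as ordered pairs `i < j`. -/
abbrev Edge (N : ℕ) : Type := {e : Fin N × Fin N // e.1 < e.2}

/-- A global configuration: the local state of every vertex. -/
abbrev Config (N S : ℕ) : Type := Fin N → Fin S

/-- The weighted adjacency matrix `a i j = w i j * b i j`, symmetric with zero diagonal,
built from the link weights `w` and the link indicators `b`. -/
def adj {N : ℕ} (w b : Edge N → ℝ) (i j : Fin N) : ℝ :=
  if h : i < j then w ⟨(i, j), h⟩ * b ⟨(i, j), h⟩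
  else if h : j < i then w ⟨(j, i), h⟩ * b ⟨(j, i), h⟩
  else 0

/-- The average degree `⟨d⟩ = (N - 1) p μ`. -/
def avgDegree (N : ℕ) (p μ : ℝ) : ℝ := ((N : ℝ) - 1) * (p * μ)

/-- The random variables `w e`, `b e` form a weighted Erdős–Rényi graph: all of them are
mutually independent, the weights have law `ν`, and `b e` is the indicator of an event of
probability `p`. -/
structure IsWeightedErdosRenyi {Ω : Type*} [MeasurableSpace Ω] (P : Measure Ω) {N : ℕ}
    (ν : Measure ℝ) (p : ℝ) (w b : Edge N → Ω → ℝ) : Prop where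
  p_mem : p ∈ Set.Icc (0 : ℝ) 1
  measurable_w : ∀ e, Measurable (w e)
  measurable_b : ∀ e, Measurable (b e)
  law_w : ∀ e, P.map (w e) = ν
  b_zero_or_one : ∀ e, ∀ᵐ ω ∂P, b e ω = 0 ∨ b e ω = 1
  prob_b : ∀ e, P {ω | b e ω = 1} = ENNReal.ofReal p
  indep : iIndepFun (Sum.elim w b : Edge N ⊕ Edge N → Ω → ℝ) P

/-- `Q φ k s` is the rate of a transition from `s` to `k` in the environment `φ`: it is
nonnegative for `k ≠ s` in every environment with nonnegative coordinates, and the diagonal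
entries are given by the usual convention. -/
structure IsRateFunction {S : ℕ} (Q : (Fin S → ℝ) → Matrix (Fin S) (Fin S) ℝ) : Prop where
  nonneg : ∀ φ : Fin S → ℝ, (∀ s, 0 ≤ φ s) → ∀ k s, k ≠ s → 0 ≤ Q φ k s
  diag : ∀ φ s, Q φ s s = -∑ k ∈ Finset.univ.erase s, Q φ k s

/-- The environment of vertex `i`: `(1 / d) ∑ j, a i j • v j`. -/
def environment {N S : ℕ} (d : ℝ) (a : Fin N → Fin N → ℝ) (v : Fin N → Fin S → ℝ)
    (i : Fin N) : Fin S → ℝ :=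
  d⁻¹ • ∑ j, a i j • v j

/-- The average of the vectors attached to the vertices. -/
def average {N S : ℕ} (v : Fin N → Fin S → ℝ) : Fin S → ℝ :=
  (N : ℝ)⁻¹ • ∑ i, v i

/-- The indicator vectors `ξ_{s,i}` of a configuration. -/
def indicators {N S : ℕ} (η : Config N S) (i : Fin N) : Fin S → ℝ :=
  fun s => if η i = s then 1 else 0

/-- The generator of the exact system on the graph `a`: the entry at `(η, η')` is the rate of
the jump from `η` to `η'`. Only one vertex changes its state at a time, and vertex `i` jumps
from `η i` to `k` at rate `Q φ_i k (η i)`. On the diagonal the sum runs over all vertices and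
gives minus the total jump rate out of `η`. -/
def generator {N S : ℕ} (Q : (Fin S → ℝ) → Matrix (Fin S) (Fin S) ℝ) (d : ℝ)
    (a : Fin N → Fin N → ℝ) : Matrix (Config N S) (Config N S) ℝ :=
  fun η η' => ∑ i, if ∀ j, j ≠ i → η' j = η j
    then Q (environment d a (indicators η) i) (η' i) (η i) else 0

/-- The σ-algebra generated by the graph and by the process up to time `r`. -/
@[reducible] def history {Ω : Type*} {N S : ℕ} (a : Ω → Fin N → Fin N → ℝ) (ξ : ℝ → Ω → Config N S)
    (r : ℝ) : MeasurableSpace Ω :=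
  MeasurableSpace.comap a inferInstance ⊔
    ⨆ q ∈ Set.Icc (0 : ℝ) r, MeasurableSpace.comap (ξ q) inferInstance

/-- `ξ` is a local density-dependent Markov process in the random environment `a`:
conditionally on the graph it is a continuous-time Markov chain with the transition semigroup
`exp (t • generator)`, and almost all of its paths are càdlàg (for the discrete topology). -/
structure IsLocalDensityProcess {Ω : Type*} [MeasurableSpace Ω] (P : Measure Ω) {N S : ℕ}
    (Q : (Fin S → ℝ) → Matrix (Fin S) (Fin S) ℝ) (d : ℝ) (a : Ω → Fin N → Fin N → ℝ)
    (ξ : ℝ → Ω → Config N S) : Prop where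
  measurable : ∀ t, 0 ≤ t → Measurable (ξ t)
  right_cont : ∀ᵐ ω ∂P, ∀ t, 0 ≤ t → ∀ᶠ r in 𝓝[>] t, ξ r ω = ξ t ω
  left_lim : ∀ᵐ ω ∂P, ∀ t, 0 < t → ∃ η, ∀ᶠ r in 𝓝[<] t, ξ r ω = η
  markov : ∀ r t, 0 ≤ r → r ≤ t → ∀ η : Config N S,
    P[Set.indicator {ω | ξ t ω = η} (fun _ => (1 : ℝ)) | history a ξ r] =ᵐ[P]
      fun ω => NormedSpace.exp ((t - r) • generator Q d (a ω)) (ξ r ω) η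

/-- `z` solves the NIMFA system on the graph `a`, from initial values in the simplex. -/
structure IsNIMFA {N S : ℕ} (Q : (Fin S → ℝ) → Matrix (Fin S) (Fin S) ℝ) (d : ℝ)
    (a : Fin N → Fin N → ℝ) (z : ℝ → Fin N → Fin S → ℝ) : Prop where
  init : ∀ i, z 0 i ∈ stdSimplex ℝ (Fin S)
  ode : ∀ t, 0 ≤ t → ∀ i, HasDerivWithinAt (fun r => z r i)
    (Q (environment d a (z t) i) *ᵥ z t i) (Set.Ici 0) t

/-- `u` solves the homogeneous mean-field equation, from an initial value in the simplex. -/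
structure IsMeanFieldSolution {S : ℕ} (Q : (Fin S → ℝ) → Matrix (Fin S) (Fin S) ℝ)
    (u : ℝ → Fin S → ℝ) : Prop where
  init : u 0 ∈ stdSimplex ℝ (Fin S)
  ode : ∀ t, 0 ≤ t → HasDerivWithinAt u (Q (u t) *ᵥ u t) (Set.Ici 0) t

/-- The distance of two vectors in the 1-norm. -/
def dist1 {S : ℕ} (v v' : Fin S → ℝ) : ℝ≥0∞ := ENNReal.ofReal (∑ s, |v s - v' s|)

/-- The uniform distance on `[0, T]` of two vector-valued functions. -/
def supDist {S : ℕ} (T : ℝ) (v v' : ℝ → Fin S → ℝ) : ℝ≥0∞ :=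
  ⨆ t ∈ Set.Icc (0 : ℝ) T, dist1 (v t) (v' t)

/-- Convergence to zero in probability of nonnegative variables `Z N`, each defined on its own
probability space. -/
def TendstoZeroInProbability {Ω : ℕ → Type*} [∀ N, MeasurableSpace (Ω N)]
    (P : ∀ N, Measure (Ω N)) (Z : ∀ N, Ω N → ℝ≥0∞) : Prop :=
  ∀ ε : ℝ≥0∞, 0 < ε → Tendsto (fun N => P N {ω | ε ≤ Z N ω}) atTop (𝓝 0)

end MeanField

end

open MeanField

/-!
Both limits rest on one deterministic property of the graph, `IsWellMixed`: for all vertex data in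
the simplex, the environments lie in a region on which the rates are Lipschitz, and on average over
the vertices they are within `r` of the global average. On such a graph the average of NIMFA
satisfies the mean-field equation up to an error `O(r)`, and Grönwall's inequality applies. So does
the density of the Markov chain, up to a noise term. Along a time grid fine enough for `1 + h G` to
replace `exp (h G)`, that noise is a martingale of variance `O(1 / N)`, which Doob's inequality
controls; right-continuity passes from dyadic times to all times.

The graph is well mixed with high probability because the columns of its centered and normalized
adjacency matrix are short and nearly orthogonal in mean square as soon as `N p ^ 2 → ∞`, which
bounds the matrix uniformly over all bounded vectors. For rates that are only locally Lipschitz, an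
exponential moment of the weights bounds all degrees simultaneously by Chernoff's inequality, which
keeps the environments in a fixed box.
-/

namespace MeanField

section Quasipositivity

theorem hasDerivAt_sq_negPart (x : ℝ) : HasDerivAt (fun y : ℝ => y⁻ ^ 2) (-(2 * x⁻)) x := by
  rcases lt_trichotomy x 0 with hx | rfl | hx
  · have heq : (fun y : ℝ => y⁻ ^ 2) =ᶠ[𝓝 x] fun y => y ^ 2 := by
      filter_upwards [gt_mem_nhds hx] with y hy
      rw [negPart_of_nonpos hy.le, neg_sq]
    simpa [negPart_of_nonpos hx.le] using (hasDerivAt_pow 2 x).congr_of_eventuallyEq heq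
  · have hbigO : (fun y : ℝ => y⁻ ^ 2) =O[𝓝 0] fun y => ‖y - 0‖ ^ 2 := by
      refine Asymptotics.IsBigO.of_bound 1 (Eventually.of_forall fun y => ?_)
      rw [one_mul, sub_zero, norm_pow, norm_pow, norm_norm, Real.norm_of_nonneg (negPart_nonneg y)]
      gcongr
      exact sup_le (neg_le_abs y) (abs_nonneg y)
    simpa using (hbigO.hasFDerivAt one_lt_two).hasDerivAt
  · have heq : (fun y : ℝ => y⁻ ^ 2) =ᶠ[𝓝 x] fun _ => 0 := by
      filter_upwards [lt_mem_nhds hx] with y hy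
      rw [negPart_of_nonneg hy.le, zero_pow two_ne_zero]
    simpa [negPart_of_nonneg hx.le] using (hasDerivAt_const x (0 : ℝ)).congr_of_eventuallyEq heq

theorem nonpos_of_deriv_right_le_mul {f f' : ℝ → ℝ} {K T : ℝ} (hf : ContinuousOn f (Set.Icc 0 T))
    (hf' : ∀ t ∈ Set.Ico 0 T, HasDerivWithinAt f (f' t) (Set.Ici t) t) (h0 : f 0 ≤ 0)
    (hle : ∀ t ∈ Set.Ico 0 T, f' t ≤ K * f t) : ∀ t ∈ Set.Icc 0 T, f t ≤ 0 := by
  intro t ht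
  have hbound := le_gronwallBound_of_liminf_deriv_right_le (δ := 0) (K := K) (ε := 0) hf
    (fun x hx r hr => (hf' x hx).liminf_right_slope_le hr) h0 (by simpa using hle) t ht
  rwa [gronwallBound_ε0_δ0] at hbound

variable {ι : Type*} [Fintype ι]

theorem sq_norm_le_sum_sq (v : ι → ℝ) : ‖v‖ ^ 2 ≤ ∑ i, v i ^ 2 := by
  refine (Real.le_sqrt (norm_nonneg _) (by positivity)).1 ?_
  refine (pi_norm_le_iff_of_nonneg (Real.sqrt_nonneg _)).2 fun i => Real.abs_le_sqrt ?_
  exact Finset.single_le_sum (f := fun i => v i ^ 2) (fun _ _ => sq_nonneg _) (Finset.mem_univ i)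

/- Grönwall's inequality for `∑ i, (f t i)⁻ ^ 2`, which vanishes initially. -/
theorem nonneg_of_neg_mul_norm_negPart_le_deriv_right {f f' : ℝ → ι → ℝ} {C T : ℝ}
    (hf : ContinuousOn f (Set.Icc 0 T))
    (hf' : ∀ t ∈ Set.Ico 0 T, HasDerivWithinAt f (f' t) (Set.Ici t) t) (h0 : 0 ≤ f 0)
    (hC : 0 ≤ C) (hle : ∀ t ∈ Set.Ico 0 T, ∀ i, f t i ≤ 0 → -(C * ‖(f t)⁻‖) ≤ f' t i) :
    ∀ t ∈ Set.Icc 0 T, 0 ≤ f t := by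
  have hderiv : ∀ t ∈ Set.Ico 0 T, HasDerivWithinAt (fun r => ∑ i, (f r i)⁻ ^ 2)
      (∑ i, -(2 * (f t i)⁻) * f' t i) (Set.Ici t) t := fun t ht =>
    HasDerivWithinAt.fun_sum fun i _ => HasDerivAt.comp_hasDerivWithinAt
      (h₂ := fun y : ℝ => y⁻ ^ 2) t (hasDerivAt_sq_negPart (f t i))
      (hasDerivWithinAt_pi.1 (hf' t ht) i)
  have hcont : ContinuousOn (fun r => ∑ i, (f r i)⁻ ^ 2) (Set.Icc 0 T) :=
    continuousOn_finsetSum _ fun i _ => Continuous.comp_continuousOn (g := fun y : ℝ => y⁻ ^ 2)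
      (continuous_iff_continuousAt.2 fun y => (hasDerivAt_sq_negPart y).continuousAt)
      (continuousOn_pi.1 hf i)
  have hterm : ∀ t ∈ Set.Ico 0 T, ∀ i, -(2 * (f t i)⁻) * f' t i ≤ 2 * C * ‖(f t)⁻‖ ^ 2 := by
    intro t ht i
    have hneg : (f t i)⁻ ≤ ‖(f t)⁻‖ := (le_abs_self _).trans (norm_le_pi_norm (f t)⁻ i)
    rcases le_total (f t i) 0 with hi | hi
    · nlinarith [hle t ht i hi, negPart_nonneg (f t i), mul_nonneg hC (norm_nonneg (f t)⁻)]
    · rw [negPart_of_nonneg hi]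
      simp only [mul_zero, neg_zero, zero_mul]
      positivity
  have hzero := nonpos_of_deriv_right_le_mul (K := Fintype.card ι * (2 * C)) hcont hderiv
    (Finset.sum_eq_zero fun i _ => by rw [negPart_of_nonneg (h0 i), zero_pow two_ne_zero]).le
    (fun t ht => by
      calc _ ≤ ∑ _i : ι, 2 * C * ‖(f t)⁻‖ ^ 2 := Finset.sum_le_sum fun i _ => hterm t ht i
        _ = Fintype.card ι * (2 * C) * ‖(f t)⁻‖ ^ 2 := by simp [mul_assoc]
        _ ≤ _ := by gcongr; exact sq_norm_le_sum_sq (f t)⁻)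
  intro t ht i
  have hsum : ∑ i, (f t i)⁻ ^ 2 = 0 := (hzero t ht).antisymm (by positivity)
  have hi := (Finset.sum_eq_zero_iff_of_nonneg fun i _ => sq_nonneg _).1 hsum i (Finset.mem_univ i)
  exact negPart_eq_zero.1 (pow_eq_zero_iff two_ne_zero |>.1 hi)

end Quasipositivity

section Graphs

variable {N S : ℕ} {Q : (Fin S → ℝ) → Matrix (Fin S) (Fin S) ℝ} {D : Set (Fin S → ℝ)} {d : ℝ}
  {a : Fin N → Fin N → ℝ} {v : Fin N → Fin S → ℝ}

section Environment

theorem environment_apply (d : ℝ) (a : Fin N → Fin N → ℝ) (v : Fin N → Fin S → ℝ) (i : Fin N)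
    (s : Fin S) : environment d a v i s = d⁻¹ * ∑ j, a i j * v j s := by
  simp [environment]

theorem average_apply (v : Fin N → Fin S → ℝ) (s : Fin S) :
    average v s = (N : ℝ)⁻¹ * ∑ i, v i s := by
  simp [average]

theorem environment_sub (d : ℝ) (a : Fin N → Fin N → ℝ) (v v' : Fin N → Fin S → ℝ) (i : Fin N) :
    environment d a (v - v') i = environment d a v i - environment d a v' i := by
  ext s
  simp [environment_apply, mul_sub]

theorem environment_nonneg (hd : 0 ≤ d) (ha : ∀ i j, 0 ≤ a i j) (hv : 0 ≤ v) (i : Fin N)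
    (s : Fin S) : 0 ≤ environment d a v i s := by
  rw [environment_apply]
  exact mul_nonneg (inv_nonneg.2 hd) (Finset.sum_nonneg fun j _ => mul_nonneg (ha i j) (hv j s))

theorem norm_environment_le (d : ℝ) (a : Fin N → Fin N → ℝ) (v : Fin N → Fin S → ℝ) (i : Fin N) :
    ‖environment d a v i‖ ≤ |d|⁻¹ * (∑ i, ∑ j, |a i j|) * ‖v‖ := by
  rw [environment, norm_smul, norm_inv, Real.norm_eq_abs, mul_assoc]
  gcongr
  calc ‖∑ j, a i j • v j‖ ≤ ∑ j, |a i j| * ‖v‖ := by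
        refine norm_sum_le_of_le _ fun j _ => ?_
        rw [norm_smul, Real.norm_eq_abs]
        gcongr
        exact norm_le_pi_norm v j
    _ = (∑ j, |a i j|) * ‖v‖ := (Finset.sum_mul ..).symm
    _ ≤ (∑ i, ∑ j, |a i j|) * ‖v‖ := mul_le_mul_of_nonneg_right
        (Finset.single_le_sum (f := fun i => ∑ j, |a i j|) (fun _ _ => by positivity)
          (Finset.mem_univ i)) (norm_nonneg v)

end Environment

section Rates

theorem exists_forall_lipschitzOnWith {ι α β : Type*} [Finite ι] [PseudoEMetricSpace α]
    [PseudoEMetricSpace β] {f : ι → α → β} {s : Set α} (h : ∀ i, ∃ K, LipschitzOnWith K (f i) s) :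
    ∃ K, ∀ i, LipschitzOnWith K (f i) s := by
  choose K hK using h
  obtain ⟨M, hM⟩ := Finite.exists_le K
  exact ⟨M, fun i => (hK i).weaken (hM i)⟩

theorem exists_forall_norm_le {ι α E : Type*} [Finite ι] [TopologicalSpace α]
    [SeminormedAddCommGroup E] {f : ι → α → E} {s : Set α} (hs : IsCompact s)
    (hf : ∀ i, ContinuousOn (f i) s) : ∃ B : NNReal, ∀ i, ∀ x ∈ s, ‖f i x‖ ≤ B := by
  choose B hB using fun i => hs.exists_bound_of_continuousOn (hf i)
  obtain ⟨M, hM⟩ := Finite.exists_le B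
  exact ⟨M.toNNReal, fun i x hx => ((hB i x hx).trans (hM i)).trans (Real.le_coe_toNNReal M)⟩

theorem exists_lipschitzOnWith_rates_of_isCompact
    (hQlip : ∀ k s, LocallyLipschitz fun φ => Q φ k s) (hD : IsCompact D) :
    ∃ L : NNReal, ∀ k s, LipschitzOnWith L (fun φ => Q φ k s) D := by
  obtain ⟨L, hL⟩ := exists_forall_lipschitzOnWith (f := fun (q : Fin S × Fin S) φ => Q φ q.1 q.2)
    fun q => ((hQlip q.1 q.2).locallyLipschitzOn (s := D)).exists_lipschitzOnWith_of_compact hD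
  exact ⟨L, fun k s => hL (k, s)⟩

theorem exists_abs_rates_le_of_isCompact
    (hQlip : ∀ k s, LocallyLipschitz fun φ => Q φ k s) (hD : IsCompact D) :
    ∃ B : NNReal, ∀ k s, ∀ φ ∈ D, |Q φ k s| ≤ B := by
  obtain ⟨B, hB⟩ := exists_forall_norm_le (f := fun (q : Fin S × Fin S) φ => Q φ q.1 q.2) hD
    fun q => (hQlip q.1 q.2).continuous.continuousOn
  exact ⟨B, fun k s => hB (k, s)⟩

theorem IsRateFunction.sum_col (hQ : IsRateFunction Q) (φ : Fin S → ℝ) (s : Fin S) :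
    ∑ k, Q φ k s = 0 := by
  rw [← Finset.add_sum_erase _ _ (Finset.mem_univ s), hQ.diag, neg_add_cancel]

theorem IsRateFunction.sum_mulVec (hQ : IsRateFunction Q) (φ v : Fin S → ℝ) :
    ∑ s, (Q φ *ᵥ v) s = 0 := by
  simp only [Matrix.mulVec, dotProduct]
  rw [Finset.sum_comm]
  simp [← Finset.sum_mul, hQ.sum_col]

end Rates

section NIMFA

variable {z : ℝ → Fin N → Fin S → ℝ} {u : ℝ → Fin S → ℝ}

theorem abs_apply_apply_le_norm (v : Fin N → Fin S → ℝ) (i : Fin N) (s : Fin S) :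
    |v i s| ≤ ‖v‖ :=
  (norm_le_pi_norm (v i) s).trans (norm_le_pi_norm v i)

theorem norm_le_of_forall_abs_apply_apply_le {r : ℝ} (hr : 0 ≤ r) (h : ∀ i s, |v i s| ≤ r) :
    ‖v‖ ≤ r :=
  (pi_norm_le_iff_of_nonneg hr).2 fun i => (pi_norm_le_iff_of_nonneg hr).2 (h i)

theorem abs_posPart_le_abs (x : ℝ) : |x⁺| ≤ |x| := by
  rw [abs_of_nonneg (posPart_nonneg x)]
  exact sup_le (le_abs_self x) (abs_nonneg x)

theorem IsNIMFA.continuousOn (hz : IsNIMFA Q d a z) : ContinuousOn z (Set.Ici 0) :=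
  continuousOn_pi.2 fun i t ht => (hz.ode t ht i).continuousWithinAt

theorem IsNIMFA.sum_eq_one (hQ : IsRateFunction Q) (hz : IsNIMFA Q d a z) {t : ℝ} (ht : 0 ≤ t)
    (i : Fin N) : ∑ s, z t i s = 1 := by
  have hderiv : ∀ r, 0 ≤ r → HasDerivWithinAt (fun r => ∑ s, z r i s) 0 (Set.Ici 0) r := by
    intro r hr
    have h := HasDerivWithinAt.fun_sum (u := Finset.univ)
      fun s _ => hasDerivWithinAt_pi.1 (hz.ode r hr i) s
    rwa [hQ.sum_mulVec] at h
  have hconst := constant_of_has_deriv_right_zero (a := 0) (b := t)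
    (fun r hr => ((hderiv r hr.1).continuousWithinAt).mono Set.Icc_subset_Ici_self)
    (fun r hr => (hderiv r hr.1).mono (Set.Ici_subset_Ici.2 hr.1)) t ⟨ht, le_rfl⟩
  exact hconst.trans (hz.init i).2

theorem neg_mul_norm_negPart_le_rate (hQ : IsRateFunction Q) (hd : 0 ≤ d) (ha : ∀ i j, 0 ≤ a i j)
    {L : NNReal} {R : ℝ}
    (hL : ∀ k s, LipschitzOnWith L (fun φ => Q φ k s) (Metric.closedBall 0 R))
    (hR : |d|⁻¹ * (∑ i, ∑ j, |a i j|) * ‖v‖ ≤ R) (i : Fin N) {k s : Fin S} (hks : k ≠ s) :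
    -(L * (|d|⁻¹ * (∑ i, ∑ j, |a i j|) * ‖v⁻‖)) ≤ Q (environment d a v i) k s := by
  have hmem : ∀ v' : Fin N → Fin S → ℝ, ‖v'‖ ≤ ‖v‖ →
      environment d a v' i ∈ Metric.closedBall 0 R := fun v' hv' => by
    rw [mem_closedBall_zero_iff]
    exact (norm_environment_le d a v' i).trans (le_trans (by gcongr) hR)
  have hpos : ‖v⁺‖ ≤ ‖v‖ := norm_le_of_forall_abs_apply_apply_le (norm_nonneg v) fun i s =>
    (abs_posPart_le_abs (v i s)).trans (abs_apply_apply_le_norm v i s)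
  have hsub : v - v⁺ = -v⁻ := by
    rw [sub_eq_iff_eq_add, neg_add_eq_sub, posPart_sub_negPart]
  have hlip : |Q (environment d a v i) k s - Q (environment d a v⁺ i) k s| ≤
      L * (|d|⁻¹ * (∑ i, ∑ j, |a i j|) * ‖v⁻‖) := by
    have h := (hL k s).norm_sub_le (hmem v le_rfl) (hmem v⁺ hpos)
    rw [← environment_sub, hsub] at h
    refine h.trans (mul_le_mul_of_nonneg_left ?_ L.2)
    simpa only [norm_neg] using norm_environment_le d a (-v⁻) i
  have hnonneg := hQ.nonneg _ (environment_nonneg hd ha (posPart_nonneg v) i) k s hks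
  linarith [neg_le_of_abs_le hlip]

theorem neg_mul_norm_negPart_le_rate_mul (hQ : IsRateFunction Q) (hd : 0 ≤ d)
    (ha : ∀ i j, 0 ≤ a i j) {L B : NNReal} {R : ℝ}
    (hL : ∀ k s, LipschitzOnWith L (fun φ => Q φ k s) (Metric.closedBall 0 R))
    (hB : ∀ k s, ∀ φ ∈ Metric.closedBall 0 R, |Q φ k s| ≤ B)
    (hR : |d|⁻¹ * (∑ i, ∑ j, |a i j|) * ‖v‖ ≤ R) (i : Fin N) {s : Fin S} (hs : v i s ≤ 0)
    (k : Fin S) :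
    -((B + L * R) * ‖v⁻‖) ≤ Q (environment d a v i) s k * v i k := by
  have hR0 : 0 ≤ R := le_trans (by positivity) hR
  have hneg : (v i k)⁻ ≤ ‖v⁻‖ := (le_abs_self _).trans (abs_apply_apply_le_norm v⁻ i k)
  have hpos : (v i k)⁺ ≤ ‖v‖ := (le_abs_self _).trans
    ((abs_posPart_le_abs (v i k)).trans (abs_apply_apply_le_norm v i k))
  have habs : |Q (environment d a v i) s k| ≤ B :=
    hB s k _ (mem_closedBall_zero_iff.2 ((norm_environment_le d a v i).trans hR))
  have hnegTerm : -(B * ‖v⁻‖) ≤ -(Q (environment d a v i) s k * (v i k)⁻) := by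
    refine neg_le_neg ?_
    have := (le_abs_self (Q (environment d a v i) s k)).trans habs
    exact mul_le_mul this hneg (negPart_nonneg _) B.2
  have hposTerm : -(L * R * ‖v⁻‖) ≤ Q (environment d a v i) s k * (v i k)⁺ := by
    rcases eq_or_ne s k with rfl | hsk
    · rw [posPart_of_nonpos hs, mul_zero]
      exact neg_nonpos.2 (by positivity)
    · have hrate := neg_mul_norm_negPart_le_rate hQ hd ha hL hR i hsk
      calc -(L * R * ‖v⁻‖) ≤ -(L * (|d|⁻¹ * (∑ i, ∑ j, |a i j|) * ‖v‖) * ‖v⁻‖) := by gcongr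
        _ = -(L * (|d|⁻¹ * (∑ i, ∑ j, |a i j|) * ‖v⁻‖)) * ‖v‖ := by ring
        _ ≤ -(L * (|d|⁻¹ * (∑ i, ∑ j, |a i j|) * ‖v⁻‖)) * (v i k)⁺ :=
          mul_le_mul_of_nonpos_left hpos (neg_nonpos.2 (by positivity))
        _ ≤ _ := mul_le_mul_of_nonneg_right hrate (posPart_nonneg _)
  calc -((B + L * R) * ‖v⁻‖) = -(L * R * ‖v⁻‖) + -(B * ‖v⁻‖) := by ring
    _ ≤ _ := add_le_add hposTerm hnegTerm
    _ = Q (environment d a v i) s k * v i k := by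
      rw [← sub_eq_add_neg, ← mul_sub, posPart_sub_negPart]

theorem IsNIMFA.nonneg (hQ : IsRateFunction Q) (hQlip : ∀ k s, LocallyLipschitz fun φ => Q φ k s)
    (hd : 0 ≤ d) (ha : ∀ i j, 0 ≤ a i j) (hz : IsNIMFA Q d a z) {t : ℝ} (ht : 0 ≤ t) :
    0 ≤ z t := by
  have hcont : ContinuousOn z (Set.Icc 0 t) := hz.continuousOn.mono Set.Icc_subset_Ici_self
  obtain ⟨Z, hZ⟩ := isCompact_Icc.exists_bound_of_continuousOn hcont
  set R : ℝ := |d|⁻¹ * (∑ i, ∑ j, |a i j|) * Z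
  have hR : ∀ r ∈ Set.Icc 0 t, |d|⁻¹ * (∑ i, ∑ j, |a i j|) * ‖z r‖ ≤ R := fun r hr =>
    mul_le_mul_of_nonneg_left (hZ r hr) (by positivity)
  have hR0 : 0 ≤ R := le_trans (by positivity) (hR 0 ⟨le_rfl, ht⟩)
  have hcompact := isCompact_closedBall (0 : Fin S → ℝ) R
  obtain ⟨L, hL⟩ := exists_lipschitzOnWith_rates_of_isCompact hQlip hcompact
  obtain ⟨B, hB⟩ := exists_abs_rates_le_of_isCompact hQlip hcompact
  have hnonneg := nonneg_of_neg_mul_norm_negPart_le_deriv_right (C := S * (B + L * R)) (T := t)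
    (f := fun r (q : Fin N × Fin S) => z r q.1 q.2)
    (f' := fun r q => (Q (environment d a (z r) q.1) *ᵥ z r q.1) q.2)
    (continuousOn_pi.2 fun q => continuousOn_pi.1 (continuousOn_pi.1 hcont q.1) q.2)
    (fun r hr => hasDerivWithinAt_pi.2 fun q =>
      (hasDerivWithinAt_pi.1 (hz.ode r hr.1 q.1) q.2).mono (Set.Ici_subset_Ici.2 hr.1))
    (fun q => (hz.init q.1).1 q.2) (by positivity)
    (fun r hr q hq => by
      have hnorm : ‖(z r)⁻‖ ≤ ‖(fun q : Fin N × Fin S => z r q.1 q.2)⁻‖ :=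
        norm_le_of_forall_abs_apply_apply_le (norm_nonneg _) fun i s =>
          norm_le_pi_norm (fun q : Fin N × Fin S => z r q.1 q.2)⁻ (i, s)
      have hterm := neg_mul_norm_negPart_le_rate_mul hQ hd ha hL hB
        (hR r ⟨hr.1, hr.2.le⟩) q.1 hq
      calc _ ≤ -(S * (B + L * R) * ‖(z r)⁻‖) := neg_le_neg (by gcongr)
        _ = ∑ _k : Fin S, -((B + L * R) * ‖(z r)⁻‖) := by simp [mul_assoc]
        _ ≤ _ := Finset.sum_le_sum fun k _ => hterm k)
    t ⟨ht, le_rfl⟩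
  exact fun i s => hnonneg (i, s)

theorem IsNIMFA.mem_stdSimplex (hQ : IsRateFunction Q)
    (hQlip : ∀ k s, LocallyLipschitz fun φ => Q φ k s) (hd : 0 ≤ d) (ha : ∀ i j, 0 ≤ a i j)
    (hz : IsNIMFA Q d a z) {t : ℝ} (ht : 0 ≤ t) (i : Fin N) : z t i ∈ stdSimplex ℝ (Fin S) :=
  ⟨hz.nonneg hQ hQlip hd ha ht i, hz.sum_eq_one hQ ht i⟩

/- The mean-field equation is the NIMFA equation on one vertex with a loop. -/
theorem IsMeanFieldSolution.mem_stdSimplex (hQ : IsRateFunction Q)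
    (hQlip : ∀ k s, LocallyLipschitz fun φ => Q φ k s) (hu : IsMeanFieldSolution Q u) {t : ℝ}
    (ht : 0 ≤ t) : u t ∈ stdSimplex ℝ (Fin S) := by
  have hloop : IsNIMFA (N := 1) Q 1 (fun _ _ => 1) (fun t _ => u t) :=
    ⟨fun _ => hu.init, fun t ht _ => by simpa [environment] using hu.ode t ht⟩
  exact hloop.mem_stdSimplex hQ hQlip zero_le_one (fun _ _ => zero_le_one) ht 0

end NIMFA

section Drift

theorem abs_le_one_of_mem_stdSimplex {x : Fin S → ℝ} (hx : x ∈ stdSimplex ℝ (Fin S))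
    (s : Fin S) : |x s| ≤ 1 := by
  rw [abs_of_nonneg (hx.1 s), ← hx.2]
  exact Finset.single_le_sum (fun k _ => hx.1 k) (Finset.mem_univ s)

theorem environment_mem_Icc {K : ℝ} (hd : 0 < d) (ha : ∀ i j, 0 ≤ a i j)
    (hdeg : ∀ i, ∑ j, a i j ≤ K * d) (hv : ∀ i, v i ∈ stdSimplex ℝ (Fin S)) (i : Fin N) :
    environment d a v i ∈ Set.Icc (0 : Fin S → ℝ) (fun _ => K) := by
  refine ⟨environment_nonneg hd.le ha (fun j => (hv j).1) i, fun s => ?_⟩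
  rw [environment_apply, inv_mul_le_iff₀ hd, mul_comm d]
  refine (Finset.sum_le_sum fun j _ => ?_).trans (hdeg i)
  exact mul_le_of_le_one_right (ha i j) (le_of_abs_le (abs_le_one_of_mem_stdSimplex (hv j) s))

theorem average_mem_stdSimplex [NeZero N] (hv : ∀ i, v i ∈ stdSimplex ℝ (Fin S)) :
    average v ∈ stdSimplex ℝ (Fin S) := by
  rw [average, Finset.smul_sum]
  exact (convex_stdSimplex ℝ (Fin S)).sum_mem (fun _ _ => by positivity)
    (by simp) (fun i _ => hv i)

theorem indicators_mem_stdSimplex (η : Config N S) (i : Fin N) :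
    indicators η i ∈ stdSimplex ℝ (Fin S) :=
  ite_eq_mem_stdSimplex ℝ (η i)

/-- The density of each local state in a configuration. -/
noncomputable abbrev density (η : Config N S) : Fin S → ℝ := average (indicators η)

theorem density_mem_stdSimplex [NeZero N] (η : Config N S) :
    density η ∈ stdSimplex ℝ (Fin S) :=
  average_mem_stdSimplex (indicators_mem_stdSimplex η)

theorem norm_mulVec_le_of_entry_le {A : Matrix (Fin S) (Fin S) ℝ} {x : Fin S → ℝ} {c r : ℝ}
    (hr : 0 ≤ r) (hc : 0 ≤ c) (hA : ∀ k s, |A k s| ≤ c) (hx : ∀ s, |x s| ≤ r) :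
    ‖A *ᵥ x‖ ≤ S * (c * r) := by
  refine (pi_norm_le_iff_of_nonneg (by positivity)).2 fun s => ?_
  calc ‖∑ k, A s k * x k‖ ≤ ∑ _k : Fin S, c * r := by
        refine norm_sum_le_of_le _ fun k _ => ?_
        rw [norm_mul]
        exact mul_le_mul (hA s k) (hx k) (norm_nonneg _) hc
    _ = S * (c * r) := by simp

/-- The rates are `L`-Lipschitz on a set `D` containing the simplex, and bounded by `B` on the
simplex itself; `D` is the region in which the environments of the vertices are expected. -/
structure RateBounds (Q : (Fin S → ℝ) → Matrix (Fin S) (Fin S) ℝ) (D : Set (Fin S → ℝ))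
    (L B : NNReal) : Prop where
  stdSimplex_subset : stdSimplex ℝ (Fin S) ⊆ D
  lipschitzOnWith : ∀ k s, LipschitzOnWith L (fun φ => Q φ k s) D
  abs_le : ∀ k s, ∀ φ ∈ stdSimplex ℝ (Fin S), |Q φ k s| ≤ B

theorem exists_rateBounds (hQlip : ∀ k s, LocallyLipschitz fun φ => Q φ k s)
    (hD : stdSimplex ℝ (Fin S) ⊆ D) (hlip : ∀ k s, ∃ L, LipschitzOnWith L (fun φ => Q φ k s) D) :
    ∃ L B, RateBounds Q D L B := by
  obtain ⟨L, hL⟩ := exists_forall_lipschitzOnWith (f := fun (q : Fin S × Fin S) φ => Q φ q.1 q.2)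
    fun q => hlip q.1 q.2
  obtain ⟨B, hB⟩ := exists_abs_rates_le_of_isCompact hQlip (isCompact_stdSimplex ℝ (Fin S))
  exact ⟨L, B, hD, fun k s => hL (k, s), hB⟩

namespace RateBounds

variable {L B : NNReal} {x y : Fin S → ℝ}

theorem abs_sub_le (hb : RateBounds Q D L B) (hx : x ∈ D) (hy : y ∈ D) (k s : Fin S) :
    |Q x k s - Q y k s| ≤ L * ‖x - y‖ :=
  (hb.lipschitzOnWith k s).norm_sub_le hx hy

theorem norm_drift_le (hb : RateBounds Q D L B) (hx : x ∈ stdSimplex ℝ (Fin S)) :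
    ‖Q x *ᵥ x‖ ≤ S * B := by
  simpa using norm_mulVec_le_of_entry_le zero_le_one B.2 (fun k s => hb.abs_le k s x hx)
    (abs_le_one_of_mem_stdSimplex hx)

theorem norm_drift_sub_le (hb : RateBounds Q D L B) (hx : x ∈ stdSimplex ℝ (Fin S))
    (hy : y ∈ stdSimplex ℝ (Fin S)) :
    ‖Q x *ᵥ x - Q y *ᵥ y‖ ≤ S * (L + B) * ‖x - y‖ := by
  have hD := hb.stdSimplex_subset
  have hrate : ‖(Q x - Q y) *ᵥ x‖ ≤ S * (L * ‖x - y‖ * 1) :=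
    norm_mulVec_le_of_entry_le zero_le_one (by positivity) (hb.abs_sub_le (hD hx) (hD hy))
      (abs_le_one_of_mem_stdSimplex hx)
  have hstate : ‖Q y *ᵥ (x - y)‖ ≤ S * (B * ‖x - y‖) :=
    norm_mulVec_le_of_entry_le (norm_nonneg _) B.2 (fun k s => hb.abs_le k s y hy)
      (fun s => norm_le_pi_norm (x - y) s)
  calc ‖Q x *ᵥ x - Q y *ᵥ y‖ = ‖(Q x - Q y) *ᵥ x + Q y *ᵥ (x - y)‖ := by
        rw [Matrix.sub_mulVec, Matrix.mulVec_sub, sub_add_sub_cancel]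
    _ ≤ S * (L * ‖x - y‖ * 1) + S * (B * ‖x - y‖) := norm_add_le_of_le hrate hstate
    _ = S * (L + B) * ‖x - y‖ := by ring

end RateBounds

/-- The mean distance of the environments of the vertices from the global average. -/
noncomputable def deviation (d : ℝ) (a : Fin N → Fin N → ℝ) (v : Fin N → Fin S → ℝ) : ℝ :=
  (N : ℝ)⁻¹ * ∑ i, ‖environment d a v i - average v‖

/-- The velocity of the average of the NIMFA system on the graph `a` at the state `v`. For the
indicators of a configuration this is the expected velocity of the density. -/
noncomputable def averageDrift (Q : (Fin S → ℝ) → Matrix (Fin S) (Fin S) ℝ) (d : ℝ)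
    (a : Fin N → Fin N → ℝ) (v : Fin N → Fin S → ℝ) : Fin S → ℝ :=
  average fun i => Q (environment d a v i) *ᵥ v i

/-- The deterministic property of the graph from which both convergences follow: whatever the
states of the vertices, all environments lie in `D` and on average they are within `r` of the
global average. -/
structure IsWellMixed (D : Set (Fin S → ℝ)) (d r : ℝ) (a : Fin N → Fin N → ℝ) : Prop where
  nonneg : ∀ i j, 0 ≤ a i j
  environment_mem : ∀ v : Fin N → Fin S → ℝ, (∀ i, v i ∈ stdSimplex ℝ (Fin S)) →
    ∀ i, environment d a v i ∈ D
  deviation_le : ∀ v : Fin N → Fin S → ℝ, (∀ i, v i ∈ stdSimplex ℝ (Fin S)) →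
    deviation d a v ≤ r

theorem deviation_nonneg (d : ℝ) (a : Fin N → Fin N → ℝ) (v : Fin N → Fin S → ℝ) :
    0 ≤ deviation d a v := by
  unfold deviation
  positivity

theorem averageDrift_sub_drift_average (Q : (Fin S → ℝ) → Matrix (Fin S) (Fin S) ℝ) (d : ℝ)
    (a : Fin N → Fin N → ℝ) (v : Fin N → Fin S → ℝ) :
    averageDrift Q d a v - Q (average v) *ᵥ average v =
      (N : ℝ)⁻¹ • ∑ i, (Q (environment d a v i) - Q (average v)) *ᵥ v i := by
  have hmean : Q (average v) *ᵥ average v = (N : ℝ)⁻¹ • ∑ i, Q (average v) *ᵥ v i := by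
    conv_lhs => enter [2]; unfold average
    rw [Matrix.mulVec_smul, Matrix.mulVec_sum]
  rw [hmean, averageDrift, average, ← smul_sub, ← Finset.sum_sub_distrib]
  simp only [Matrix.sub_mulVec]

namespace IsWellMixed

variable [NeZero N] {L B : NNReal} {r : ℝ}

theorem norm_averageDrift_sub_le (ha : IsWellMixed D d r a) (hb : RateBounds Q D L B)
    (hv : ∀ i, v i ∈ stdSimplex ℝ (Fin S)) :
    ‖averageDrift Q d a v - Q (average v) *ᵥ average v‖ ≤ S * L * r := by
  have hterm : ∀ i, ‖(Q (environment d a v i) - Q (average v)) *ᵥ v i‖ ≤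
      S * (L * ‖environment d a v i - average v‖ * 1) := fun i =>
    norm_mulVec_le_of_entry_le zero_le_one (by positivity)
      (hb.abs_sub_le (ha.environment_mem v hv i) (hb.stdSimplex_subset (average_mem_stdSimplex hv)))
      (abs_le_one_of_mem_stdSimplex (hv i))
  rw [averageDrift_sub_drift_average, norm_smul, Real.norm_of_nonneg (by positivity)]
  calc _ ≤ (N : ℝ)⁻¹ * ∑ i, S * (L * ‖environment d a v i - average v‖ * 1) := by
        gcongr
        exact norm_sum_le_of_le _ fun i _ => hterm i
    _ = S * L * deviation d a v := by
        simp only [mul_one, ← mul_assoc, ← Finset.mul_sum, deviation]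
        ring
    _ ≤ S * L * r := by gcongr; exact ha.deviation_le v hv

theorem sum_abs_rate_le (ha : IsWellMixed D d r a) (hb : RateBounds Q D L B)
    (hv : ∀ i, v i ∈ stdSimplex ℝ (Fin S)) (k s : Fin N → Fin S) :
    ∑ i, |Q (environment d a v i) (k i) (s i)| ≤ N * (B + L * r) := by
  have hav := average_mem_stdSimplex hv
  have hterm : ∀ i, |Q (environment d a v i) (k i) (s i)| ≤
      B + L * ‖environment d a v i - average v‖ := fun i => by
    have hlip := hb.abs_sub_le (ha.environment_mem v hv i) (hb.stdSimplex_subset hav) (k i) (s i)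
    linarith [abs_sub_abs_le_abs_sub (Q (environment d a v i) (k i) (s i))
      (Q (average v) (k i) (s i)), hb.abs_le (k i) (s i) _ hav]
  calc _ ≤ ∑ i, (B + L * ‖environment d a v i - average v‖) := Finset.sum_le_sum fun i _ => hterm i
    _ = N * (B + L * deviation d a v) := by
        rw [Finset.sum_add_distrib, ← Finset.mul_sum, deviation]
        simp only [Finset.sum_const, Finset.card_univ, Fintype.card_fin, nsmul_eq_mul]
        field_simp [NeZero.ne N]
    _ ≤ N * (B + L * r) := by gcongr; exact ha.deviation_le v hv

end IsWellMixed

end Drift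

section Stability

variable {L B : NNReal} {r δ T t : ℝ} {z : ℝ → Fin N → Fin S → ℝ} {u : ℝ → Fin S → ℝ}

theorem gronwallBound_le {δ K ε x : ℝ} (hK : 0 ≤ K) (hε : 0 ≤ ε) :
    gronwallBound δ K ε x ≤ (δ + ε * x) * Real.exp (K * x) := by
  rcases hK.eq_or_lt with rfl | hK
  · simp [gronwallBound_K0]
  have hexp : Real.exp (K * x) - 1 ≤ K * x * Real.exp (K * x) := by
    have hone : Real.exp (-(K * x)) * Real.exp (K * x) = 1 := by rw [← Real.exp_add]; simp
    nlinarith [Real.exp_pos (K * x), Real.add_one_le_exp (-(K * x))]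
  calc gronwallBound δ K ε x = δ * Real.exp (K * x) + ε / K * (Real.exp (K * x) - 1) := by
        rw [gronwallBound_of_K_ne_0 hK.ne']
    _ ≤ δ * Real.exp (K * x) + ε / K * (K * x * Real.exp (K * x)) := by gcongr
    _ = (δ + ε * x) * Real.exp (K * x) := by field_simp

theorem IsNIMFA.hasDerivWithinAt_average (hz : IsNIMFA Q d a z) (ht : 0 ≤ t) :
    HasDerivWithinAt (fun t => average (z t)) (averageDrift Q d a (z t)) (Set.Ici 0) t :=
  (HasDerivWithinAt.fun_sum fun i _ => hz.ode t ht i).const_smul (N : ℝ)⁻¹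

variable [NeZero N]

theorem IsNIMFA.norm_averageDrift_sub_le (hQ : IsRateFunction Q)
    (hQlip : ∀ k s, LocallyLipschitz fun φ => Q φ k s) (hd : 0 ≤ d) (hb : RateBounds Q D L B)
    (ha : IsWellMixed D d r a) (hz : IsNIMFA Q d a z) (hu : IsMeanFieldSolution Q u)
    (ht : 0 ≤ t) :
    ‖averageDrift Q d a (z t) - Q (u t) *ᵥ u t‖ ≤
      S * (L + B) * ‖average (z t) - u t‖ + S * L * r := by
  have hzt := hz.mem_stdSimplex hQ hQlip hd ha.nonneg ht
  calc _ ≤ ‖averageDrift Q d a (z t) - Q (average (z t)) *ᵥ average (z t)‖ +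
        ‖Q (average (z t)) *ᵥ average (z t) - Q (u t) *ᵥ u t‖ :=
        norm_sub_le_norm_sub_add_norm_sub _ _ _
    _ ≤ S * L * r + S * (L + B) * ‖average (z t) - u t‖ :=
        add_le_add (ha.norm_averageDrift_sub_le hb hzt)
          (hb.norm_drift_sub_le (average_mem_stdSimplex hzt) (hu.mem_stdSimplex hQ hQlip ht))
    _ = _ := add_comm _ _

theorem IsNIMFA.norm_average_sub_le (hQ : IsRateFunction Q)
    (hQlip : ∀ k s, LocallyLipschitz fun φ => Q φ k s) (hd : 0 ≤ d) (hb : RateBounds Q D L B)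
    (ha : IsWellMixed D d r a) (hz : IsNIMFA Q d a z) (hu : IsMeanFieldSolution Q u)
    (hδ : ‖average (z 0) - u 0‖ ≤ δ) (ht : t ∈ Set.Icc 0 T) :
    ‖average (z t) - u t‖ ≤ (δ + S * L * r * T) * Real.exp (S * (L + B) * T) := by
  have hderiv : ∀ t, 0 ≤ t → HasDerivWithinAt (fun t => average (z t) - u t)
      (averageDrift Q d a (z t) - Q (u t) *ᵥ u t) (Set.Ici 0) t := fun t ht =>
    (hz.hasDerivWithinAt_average ht).sub (hu.ode t ht)
  have hgronwall := norm_le_gronwallBound_of_norm_deriv_right_le (a := 0) (b := T)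
    (fun x hx => ((hderiv x hx.1).continuousWithinAt).mono Set.Icc_subset_Ici_self)
    (fun x hx => (hderiv x hx.1).mono (Set.Ici_subset_Ici.2 hx.1)) hδ
    (fun x hx => hz.norm_averageDrift_sub_le hQ hQlip hd hb ha hu hx.1) t ht
  have hr : 0 ≤ r := (deviation_nonneg d a (z 0)).trans (ha.deviation_le _ hz.init)
  have hδ0 : 0 ≤ δ := (norm_nonneg _).trans hδ
  have hT : 0 ≤ T := ht.1.trans ht.2
  calc _ ≤ (δ + S * L * r * t) * Real.exp (S * (L + B) * t) := by
        simpa only [sub_zero] using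
          hgronwall.trans (gronwallBound_le (by positivity) (by positivity))
    _ ≤ (δ + S * L * r * T) * Real.exp (S * (L + B) * T) := by
        gcongr <;> exact ht.2

theorem IsMeanFieldSolution.continuousOn (hu : IsMeanFieldSolution Q u) :
    ContinuousOn u (Set.Ici 0) :=
  fun t ht => (hu.ode t ht).continuousWithinAt

theorem IsMeanFieldSolution.norm_eulerStep_le (hQ : IsRateFunction Q)
    (hQlip : ∀ k s, LocallyLipschitz fun φ => Q φ k s) (hb : RateBounds Q D L B)
    (hu : IsMeanFieldSolution Q u) {h : ℝ} (ht : 0 ≤ t) (hh : 0 ≤ h) :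
    ‖u (t + h) - u t - h • (Q (u t) *ᵥ u t)‖ ≤ S * (L + B) * (S * B) * h * h := by
  have hus : ∀ r ∈ Set.Ico t (t + h), u r ∈ stdSimplex ℝ (Fin S) := fun r hr =>
    hu.mem_stdSimplex hQ hQlip (ht.trans hr.1)
  have hcont : ContinuousOn u (Set.Icc t (t + h)) :=
    hu.continuousOn.mono fun r hr => ht.trans hr.1
  have hderiv : ∀ r ∈ Set.Ico t (t + h), HasDerivWithinAt u (Q (u r) *ᵥ u r) (Set.Ici r) r :=
    fun r hr => (hu.ode r (ht.trans hr.1)).mono (Set.Ici_subset_Ici.2 (ht.trans hr.1))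
  have hincr : ∀ r ∈ Set.Icc t (t + h), ‖u r - u t‖ ≤ S * B * (r - t) :=
    norm_image_sub_le_of_norm_deriv_right_le_segment hcont hderiv
      fun r hr => hb.norm_drift_le (hus r hr)
  have hbound : ∀ r ∈ Set.Ico t (t + h),
      ‖Q (u r) *ᵥ u r - (1 : ℝ) • (Q (u t) *ᵥ u t)‖ ≤ S * (L + B) * (S * B) * h := fun r hr => by
    calc _ ≤ S * (L + B) * ‖u r - u t‖ := by
          simpa only [one_smul] using
            hb.norm_drift_sub_le (hus r hr) (hu.mem_stdSimplex hQ hQlip ht)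
      _ ≤ S * (L + B) * (S * B * h) := by
          gcongr
          refine (hincr r ⟨hr.1, hr.2.le⟩).trans ?_
          gcongr
          linarith [hr.2]
      _ = _ := by ring
  have hstep := norm_image_sub_le_of_norm_deriv_right_le_segment
    (f := fun r => u r - (r - t) • (Q (u t) *ᵥ u t)) (hcont.sub (by fun_prop))
    (fun r hr => (hderiv r hr).sub
      (((hasDerivAt_id r).sub_const t).smul_const (Q (u t) *ᵥ u t)).hasDerivWithinAt)
    hbound (t + h) ⟨by linarith, le_rfl⟩
  simpa only [add_sub_cancel_left, sub_self, zero_smul, sub_zero, sub_right_comm] using hstep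

end Stability

section Homogeneity

variable {M : Fin N → Fin N → ℝ} {κ : ℝ}

/-- The Gram matrix of the columns of `M`, with its diagonal replaced by zero. -/
noncomputable def offDiagGram (M : Fin N → Fin N → ℝ) (j k : Fin N) : ℝ :=
  if j = k then 0 else ∑ i, M i j * M i k

/-- A matrix whose columns are short on average and nearly orthogonal to each other. Such a matrix
maps vectors with entries in `[-1, 1]` to vectors with small entries on average. -/
structure HasSmallGram (κ : ℝ) (M : Fin N → Fin N → ℝ) : Prop where
  sum_sq_le : ∑ i, ∑ j, M i j ^ 2 ≤ N * κ
  sum_sq_offDiagGram_le : ∑ j, ∑ k, offDiagGram M j k ^ 2 ≤ κ ^ 2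

theorem sum_sq_mulVec_eq (M : Fin N → Fin N → ℝ) (x : Fin N → ℝ) :
    ∑ i, (∑ j, M i j * x j) ^ 2 =
      ∑ i, ∑ j, M i j ^ 2 * x j ^ 2 + ∑ j, ∑ k, offDiagGram M j k * (x j * x k) := by
  have hgram : ∀ j k, ∑ i, M i j * x j * (M i k * x k) =
      (if j = k then ∑ i, M i j ^ 2 * x j ^ 2 else 0) + offDiagGram M j k * (x j * x k) := by
    intro j k
    rcases eq_or_ne j k with rfl | hjk
    · simp only [offDiagGram, if_true, zero_mul, add_zero]
      exact Finset.sum_congr rfl fun i _ => by ring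
    · simp only [offDiagGram, if_neg hjk, zero_add, Finset.sum_mul]
      exact Finset.sum_congr rfl fun i _ => by ring
  calc _ = ∑ j, ∑ k, ∑ i, M i j * x j * (M i k * x k) := by
        simp only [sq, Finset.sum_mul_sum]
        rw [Finset.sum_comm]
        exact Finset.sum_congr rfl fun j _ => Finset.sum_comm
    _ = _ := by
        simp only [hgram, Finset.sum_add_distrib, Finset.sum_ite_eq, Finset.mem_univ, if_true]
        rw [Finset.sum_comm]

theorem HasSmallGram.sum_abs_offDiagGram_le (hM : HasSmallGram κ M) (hκ : 0 ≤ κ) :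
    ∑ j, ∑ k, |offDiagGram M j k| ≤ N * κ := by
  rw [← Fintype.sum_prod_type']
  refine abs_le_of_sq_le_sq' (sq_sum_le_card_mul_sum_sq.trans ?_) (by positivity) |>.2
  calc _ = (N : ℝ) ^ 2 * ∑ j, ∑ k, offDiagGram M j k ^ 2 := by
        simp [Fintype.sum_prod_type, sq]
    _ ≤ (N : ℝ) ^ 2 * κ ^ 2 := by gcongr; exact hM.sum_sq_offDiagGram_le
    _ = _ := by ring

theorem HasSmallGram.sum_sq_mulVec_le (hM : HasSmallGram κ M) (hκ : 0 ≤ κ) {x : Fin N → ℝ}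
    (hx : ∀ j, |x j| ≤ 1) : ∑ i, (∑ j, M i j * x j) ^ 2 ≤ N * (2 * κ) := by
  have hdiag : ∑ i, ∑ j, M i j ^ 2 * x j ^ 2 ≤ ∑ i, ∑ j, M i j ^ 2 := by
    refine Finset.sum_le_sum fun i _ => Finset.sum_le_sum fun j _ => ?_
    exact mul_le_of_le_one_right (sq_nonneg _) ((sq_le_one_iff_abs_le_one _).2 (hx j))
  have hoff : ∑ j, ∑ k, offDiagGram M j k * (x j * x k) ≤ ∑ j, ∑ k, |offDiagGram M j k| := by
    refine Finset.sum_le_sum fun j _ => Finset.sum_le_sum fun k _ => (le_abs_self _).trans ?_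
    rw [abs_mul, abs_mul]
    exact mul_le_of_le_one_right (abs_nonneg _) (mul_le_one₀ (hx j) (abs_nonneg _) (hx k))
  rw [sum_sq_mulVec_eq]
  linarith [hM.sum_sq_le, hM.sum_abs_offDiagGram_le hκ]

theorem HasSmallGram.sum_abs_mulVec_le (hM : HasSmallGram κ M) (hκ : 0 ≤ κ) {x : Fin N → ℝ}
    (hx : ∀ j, |x j| ≤ 1) : ∑ i, |∑ j, M i j * x j| ≤ N * √(2 * κ) := by
  refine abs_le_of_sq_le_sq' (sq_sum_le_card_mul_sum_sq.trans ?_) (by positivity) |>.2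
  simp only [sq_abs, Finset.card_univ, Fintype.card_fin]
  calc _ ≤ (N : ℝ) * (N * (2 * κ)) := by gcongr; exact hM.sum_sq_mulVec_le hκ hx
    _ = (N * √(2 * κ)) ^ 2 := by rw [mul_pow, Real.sq_sqrt (by positivity)]; ring

/-- The normalized adjacency matrix minus its mean, with zero diagonal. -/
noncomputable def centered (d : ℝ) (a : Fin N → Fin N → ℝ) (i j : Fin N) : ℝ :=
  if i = j then 0 else d⁻¹ * a i j - ((N : ℝ) - 1)⁻¹

theorem environment_sub_average (ha : ∀ i, a i i = 0) (hN : 1 < N) (v : Fin N → Fin S → ℝ)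
    (i : Fin N) (s : Fin S) :
    environment d a v i s - average v s =
      ∑ j, centered d a i j * v j s + (average v s - v i s) / ((N : ℝ) - 1) := by
  have hN1 : (N : ℝ) - 1 ≠ 0 := (sub_pos.2 (Nat.one_lt_cast.2 hN)).ne'
  have hN0 : (N : ℝ) ≠ 0 := by positivity
  have hterm : ∀ j, centered d a i j * v j s = d⁻¹ * (a i j * v j s) -
      ((N : ℝ) - 1)⁻¹ * v j s + (if j = i then ((N : ℝ) - 1)⁻¹ * v i s else 0) := by
    intro j
    rcases eq_or_ne i j with rfl | hij
    · simp [centered, ha]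
    · rw [centered, if_neg hij, if_neg hij.symm]
      ring
  rw [environment_apply, average_apply]
  simp only [hterm, Finset.sum_add_distrib, Finset.sum_sub_distrib, ← Finset.mul_sum,
    Finset.sum_ite_eq', Finset.mem_univ, if_true]
  field_simp
  ring

theorem HasSmallGram.deviation_le (hM : HasSmallGram κ (centered d a)) (hκ : 0 ≤ κ)
    (ha : ∀ i, a i i = 0) (hN : 1 < N) (hv : ∀ i, v i ∈ stdSimplex ℝ (Fin S)) :
    deviation d a v ≤ S * (√(2 * κ) + 2 / ((N : ℝ) - 1)) := by
  have : NeZero N := ⟨by omega⟩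
  have hN1 : 0 < (N : ℝ) - 1 := sub_pos.2 (Nat.one_lt_cast.2 hN)
  have habs : ∀ i s, |environment d a v i s - average v s| ≤
      |∑ j, centered d a i j * v j s| + 2 / ((N : ℝ) - 1) := by
    intro i s
    have hdiff : |average v s - v i s| ≤ 2 := by
      linarith [abs_sub (average v s) (v i s), abs_le_one_of_mem_stdSimplex (hv i) s,
        abs_le_one_of_mem_stdSimplex (average_mem_stdSimplex hv) s]
    rw [environment_sub_average ha hN]
    refine (abs_add_le _ _).trans ?_
    rw [abs_div, abs_of_pos hN1]
    gcongr
  rw [deviation, inv_mul_le_iff₀ (Nat.cast_pos.2 (NeZero.pos N))]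
  calc ∑ i, ‖environment d a v i - average v‖
      ≤ ∑ i, ∑ s, (|∑ j, centered d a i j * v j s| + 2 / ((N : ℝ) - 1)) := by
        refine Finset.sum_le_sum fun i _ => (pi_norm_le_iff_of_nonneg (by positivity)).2 fun s => ?_
        exact (habs i s).trans (Finset.single_le_sum
          (f := fun s => |∑ j, centered d a i j * v j s| + 2 / ((N : ℝ) - 1))
          (fun _ _ => by positivity) (Finset.mem_univ s))
    _ = ∑ s, (∑ i, |∑ j, centered d a i j * v j s| + N * (2 / ((N : ℝ) - 1))) := by
        rw [Finset.sum_comm]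
        simp [Finset.sum_add_distrib]
    _ ≤ ∑ _s : Fin S, (N * √(2 * κ) + N * (2 / ((N : ℝ) - 1))) := by
        gcongr with s
        exact hM.sum_abs_mulVec_le hκ fun j => abs_le_one_of_mem_stdSimplex (hv j) s
    _ = N * (S * (√(2 * κ) + 2 / ((N : ℝ) - 1))) := by
        simp only [Finset.sum_const, Finset.card_univ, Fintype.card_fin, nsmul_eq_mul]
        ring

end Homogeneity

section Edges

/-- The edge joining two distinct vertices. -/
def edge {i j : Fin N} (h : i ≠ j) : Edge N :=
  ⟨(min i j, max i j), by rcases lt_or_gt_of_ne h with h | h <;> simp [h.le, h]⟩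

theorem edge_eq_iff {i j k l : Fin N} (h : i ≠ j) (h' : k ≠ l) :
    edge h = edge h' ↔ (i = k ∧ j = l) ∨ (i = l ∧ j = k) := by
  simp only [edge, Subtype.mk.injEq, Prod.mk.injEq]
  rcases lt_or_gt_of_ne h with h | h <;> rcases lt_or_gt_of_ne h' with h' | h' <;>
    simp only [h.le, h'.le, min_eq_left, min_eq_right, max_eq_left, max_eq_right] <;> omega

/-- The symmetric matrix with zero diagonal whose off-diagonal entries are given by `x`. -/
noncomputable def symmMatrix (x : Edge N → ℝ) (i j : Fin N) : ℝ :=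
  if h : i ≠ j then x (edge h) else 0

theorem symmMatrix_of_ne (x : Edge N → ℝ) {i j : Fin N} (h : i ≠ j) :
    symmMatrix x i j = x (edge h) :=
  dif_pos h

theorem symmMatrix_self (x : Edge N → ℝ) (i : Fin N) : symmMatrix x i i = 0 :=
  dif_neg (not_not.2 rfl)

theorem symmMatrix_nonneg {x : Edge N → ℝ} (hx : ∀ e, 0 ≤ x e) (i j : Fin N) :
    0 ≤ symmMatrix x i j := by
  unfold symmMatrix
  split_ifs
  · exact hx _
  · exact le_rfl

theorem adj_eq_symmMatrix (w b : Edge N → ℝ) : adj w b = symmMatrix fun e => w e * b e := by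
  ext i j
  rcases lt_trichotomy i j with h | rfl | h
  · simp [adj, symmMatrix, edge, h, h.le, h.ne]
  · simp [adj, symmMatrix]
  · simp [adj, symmMatrix, edge, h, h.le, h.ne', h.not_gt]

theorem centered_symmMatrix (d : ℝ) (x : Edge N → ℝ) :
    centered d (symmMatrix x) = symmMatrix fun e => d⁻¹ * x e - ((N : ℝ) - 1)⁻¹ := by
  ext i j
  by_cases h : i = j <;> simp [centered, symmMatrix, h]

theorem measurable_symmMatrix : Measurable (symmMatrix : (Edge N → ℝ) → Fin N → Fin N → ℝ) := by
  refine measurable_pi_lambda _ fun i => measurable_pi_lambda _ fun j => ?_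
  unfold symmMatrix
  split_ifs <;> fun_prop

end Edges

section Moments

variable {Ω : Type*} [MeasurableSpace Ω] {P : Measure Ω}

theorem iIndepFun_mul_of_sumElim {ι : Type*} {w b : ι → Ω → ℝ}
    (hw : ∀ i, Measurable (w i)) (hb : ∀ i, Measurable (b i)) (h : iIndepFun (Sum.elim w b) P) :
    iIndepFun (fun i ω => w i ω * b i ω) P := by
  classical
  have := h.isProbabilityMeasure
  have hmeas : ∀ q, Measurable (Sum.elim w b q) := Sum.rec hw hb
  have hstep : ∀ i (s : Finset ι), i ∉ s →
      IndepFun (fun ω => w i ω * b i ω) (fun ω (j : s) => w j ω * b j ω) P := fun i s hi =>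
    (h.indepFun_finset {Sum.inl i, Sum.inr i} (s.disjSum s) (by simp [hi]) hmeas).comp
      (φ := fun (x : ({Sum.inl i, Sum.inr i} : Finset (ι ⊕ ι)) → ℝ) =>
        x ⟨Sum.inl i, by simp⟩ * x ⟨Sum.inr i, by simp⟩)
      (ψ := fun (x : ↥(s.disjSum s) → ℝ) (j : s) =>
        x ⟨Sum.inl j, by simp⟩ * x ⟨Sum.inr j, by simp⟩)
      (by fun_prop) (by fun_prop)
  refine iIndepFun_iff_measure_inter_preimage_eq_mul.2 fun s A hA => ?_
  induction s using Finset.induction_on with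
  | empty => simp
  | insert i s hi ih =>
    have hpre : ⋂ j ∈ s, (fun ω => w j ω * b j ω) ⁻¹' A j =
        (fun ω (j : s) => w j ω * b j ω) ⁻¹' Set.pi Set.univ fun j => A j := by
      ext ω
      simp
    rw [Finset.set_biInter_insert, Finset.prod_insert hi,
      ← ih fun j hj => hA j (Finset.mem_insert_of_mem hj), hpre]
    exact (hstep i s hi).measure_inter_preimage_eq_mul _ _ (hA i (Finset.mem_insert_self i s))
      (MeasurableSet.univ_pi fun j => hA j (Finset.mem_insert_of_mem j.2))

theorem indepFun_sq {X Y : Ω → ℝ} (h : IndepFun X Y P) :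
    IndepFun (fun ω => X ω ^ 2) (fun ω => Y ω ^ 2) P :=
  h.comp (φ := fun x => x ^ 2) (ψ := fun x => x ^ 2) (by fun_prop) (by fun_prop)

theorem memLp_two_mul_of_indepFun {X Y : Ω → ℝ} (h : IndepFun X Y P) (hX : MemLp X 2 P)
    (hY : MemLp Y 2 P) : MemLp (X * Y) 2 P := by
  refine (memLp_two_iff_integrable_sq (hX.1.mul hY.1)).2 ?_
  simp only [Pi.mul_apply, mul_pow]
  exact (indepFun_sq h).integrable_mul hX.integrable_sq hY.integrable_sq

theorem integral_sq_mul_le_of_indepFun {X Y : Ω → ℝ} {V W : ℝ} (h : IndepFun X Y P)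
    (hX : MemLp X 2 P) (hY : MemLp Y 2 P) (hXV : ∫ ω, X ω ^ 2 ∂P ≤ V)
    (hYW : ∫ ω, Y ω ^ 2 ∂P ≤ W) : ∫ ω, (X * Y) ω ^ 2 ∂P ≤ V * W := by
  have hV : 0 ≤ V := (integral_nonneg fun ω => sq_nonneg (X ω)).trans hXV
  calc ∫ ω, (X * Y) ω ^ 2 ∂P = (∫ ω, X ω ^ 2 ∂P) * ∫ ω, Y ω ^ 2 ∂P := by
        simp only [Pi.mul_apply, mul_pow]
        exact (indepFun_sq h).integral_mul_eq_mul_integral (hX.1.pow 2) (hY.1.pow 2)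
    _ ≤ V * W := mul_le_mul hXV hYW (integral_nonneg fun ω => sq_nonneg (Y ω)) hV

theorem integral_sq_sum_le_of_pairwise_indepFun [IsProbabilityMeasure P] {ι : Type*}
    {s : Finset ι} {Y : ι → Ω → ℝ} {V : ℝ} (hY : ∀ i ∈ s, MemLp (Y i) 2 P)
    (hmean : ∀ i ∈ s, ∫ ω, Y i ω ∂P = 0) (hV : ∀ i ∈ s, ∫ ω, Y i ω ^ 2 ∂P ≤ V)
    (hindep : (s : Set ι).Pairwise fun i j => IndepFun (Y i) (Y j) P) :
    ∫ ω, (∑ i ∈ s, Y i ω) ^ 2 ∂P ≤ s.card * V := by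
  have hsum : ∫ ω, (∑ i ∈ s, Y i) ω ∂P = 0 := by
    simp only [Finset.sum_apply]
    rw [integral_finsetSum _ fun i hi => (hY i hi).integrable one_le_two]
    exact Finset.sum_eq_zero hmean
  have hmem : MemLp (∑ i ∈ s, Y i) 2 P := memLp_finsetSum' _ hY
  calc ∫ ω, (∑ i ∈ s, Y i ω) ^ 2 ∂P = variance (∑ i ∈ s, Y i) P := by
        simp [variance_of_integral_eq_zero hmem.1.aemeasurable hsum]
    _ = ∑ i ∈ s, variance (Y i) P := IndepFun.variance_sum hY hindep
    _ ≤ ∑ _i ∈ s, V := Finset.sum_le_sum fun i hi =>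
        (variance_le_expectation_sq (hY i hi).1).trans (by simpa using hV i hi)
    _ = s.card * V := by simp

theorem integral_sum_sum_le {ι : Type*} [Fintype ι] {f : ι → ι → Ω → ℝ} {c : ℝ}
    (hint : ∀ i j, Integrable (f i j) P) (hf : ∀ i j, ∫ ω, f i j ω ∂P ≤ c) :
    ∫ ω, ∑ i, ∑ j, f i j ω ∂P ≤ Fintype.card ι ^ 2 * c := by
  rw [integral_finsetSum _ fun i _ => integrable_finsetSum _ fun j _ => hint i j]
  calc _ ≤ ∑ _i : ι, ∑ _j : ι, c := by
        refine Finset.sum_le_sum fun i _ => ?_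
        rw [integral_finsetSum _ fun j _ => hint i j]
        exact Finset.sum_le_sum fun j _ => hf i j
    _ = _ := by
        simp only [Finset.sum_const, Finset.card_univ, nsmul_eq_mul]
        ring

variable {X : Edge N → Ω → ℝ} {V : ℝ}

theorem memLp_symmMatrix (hX : ∀ e, MemLp (X e) 2 P) (i j : Fin N) :
    MemLp (fun ω => symmMatrix (fun e => X e ω) i j) 2 P := by
  unfold symmMatrix
  split_ifs
  · exact hX _
  · exact MemLp.zero

theorem integral_sq_symmMatrix_le (hV : 0 ≤ V) (hXV : ∀ e, ∫ ω, X e ω ^ 2 ∂P ≤ V) (i j : Fin N) :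
    ∫ ω, symmMatrix (fun e => X e ω) i j ^ 2 ∂P ≤ V := by
  unfold symmMatrix
  split_ifs
  · exact hXV _
  · simpa using hV

theorem edge_ne_edge {i j k : Fin N} (hjk : j ≠ k) (hij : i ≠ j) (hik : i ≠ k) :
    edge hij ≠ edge hik := by
  rw [Ne, edge_eq_iff]
  tauto

theorem offDiagGram_symmMatrix {j k : Fin N} (hjk : j ≠ k) (x : Edge N → ℝ) :
    offDiagGram (symmMatrix x) j k =
      ∑ i : {i // i ≠ j ∧ i ≠ k}, x (edge i.2.1) * x (edge i.2.2) := by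
  have hzero : ∀ i : {i // ¬(i ≠ j ∧ i ≠ k)}, symmMatrix x i j * symmMatrix x i k = 0 := by
    rintro ⟨i, hi⟩
    rcases not_and_or.1 hi with h | h <;> simp [not_not.1 h, symmMatrix_self]
  rw [offDiagGram, if_neg hjk, ← Fintype.sum_subtype_add_sum_subtype (fun i => i ≠ j ∧ i ≠ k),
    Fintype.sum_eq_zero _ hzero, add_zero]
  exact Finset.sum_congr rfl fun i _ => by
    rw [symmMatrix_of_ne x i.2.1, symmMatrix_of_ne x i.2.2]

theorem memLp_offDiagGram_symmMatrix (hindep : iIndepFun X P) (hX : ∀ e, MemLp (X e) 2 P)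
    (j k : Fin N) : MemLp (fun ω => offDiagGram (symmMatrix fun e => X e ω) j k) 2 P := by
  rcases eq_or_ne j k with rfl | hjk
  · simp [offDiagGram]
  · simp only [offDiagGram_symmMatrix hjk]
    exact memLp_finsetSum _ fun i _ => memLp_two_mul_of_indepFun
      (hindep.indepFun (edge_ne_edge hjk i.2.1 i.2.2)) (hX _) (hX _)

theorem integral_sq_offDiagGram_symmMatrix_le (hindep : iIndepFun X P)
    (hX : ∀ e, MemLp (X e) 2 P) (hmean : ∀ e, ∫ ω, X e ω ∂P = 0)
    (hXV : ∀ e, ∫ ω, X e ω ^ 2 ∂P ≤ V) (j k : Fin N) :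
    ∫ ω, offDiagGram (symmMatrix fun e => X e ω) j k ^ 2 ∂P ≤ N * V ^ 2 := by
  have := hindep.isProbabilityMeasure
  rcases eq_or_ne j k with rfl | hjk
  · simpa [offDiagGram] using mul_nonneg N.cast_nonneg (sq_nonneg V)
  have hpair : ∀ i : {i // i ≠ j ∧ i ≠ k}, IndepFun (X (edge i.2.1)) (X (edge i.2.2)) P :=
    fun i => hindep.indepFun (edge_ne_edge hjk i.2.1 i.2.2)
  simp only [offDiagGram_symmMatrix hjk]
  refine (integral_sq_sum_le_of_pairwise_indepFun
    (Y := fun i => X (edge i.2.1) * X (edge i.2.2)) (V := V ^ 2)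
    (fun i _ => memLp_two_mul_of_indepFun (hpair i) (hX _) (hX _)) (fun i _ => ?_)
    (fun i _ => ?_) fun i _ i' _ hii' => ?_).trans ?_
  · rw [(hpair i).integral_mul_eq_mul_integral (hX _).1 (hX _).1, hmean, zero_mul]
  · simpa only [sq V] using integral_sq_mul_le_of_indepFun (hpair i) (hX _) (hX _) (hXV _) (hXV _)
  · have hne : (i : Fin N) ≠ i' := Subtype.coe_injective.ne hii'
    have hi := i.2
    refine hindep.indepFun_mul_mul₀ (fun e => (hX e).1.aemeasurable) _ _ _ _ ?_ ?_ ?_ ?_ <;>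
      rw [Ne, edge_eq_iff] <;> tauto
  · gcongr
    simpa using Fintype.card_subtype_le fun i : Fin N => i ≠ j ∧ i ≠ k

theorem measure_ge_le_ofReal_integral_div [IsFiniteMeasure P] {f : Ω → ℝ} {c : ℝ} (hf : 0 ≤ f)
    (hint : Integrable f P) (hc : 0 < c) :
    P {ω | c ≤ f ω} ≤ ENNReal.ofReal ((∫ ω, f ω ∂P) / c) := by
  rw [← ofReal_measureReal]
  refine ENNReal.ofReal_le_ofReal ((le_div_iff₀' hc).2 ?_)
  exact mul_meas_ge_le_integral_of_nonneg (Eventually.of_forall hf) hint c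

theorem measure_not_hasSmallGram_symmMatrix_le [NeZero N] (hindep : iIndepFun X P)
    (hX : ∀ e, MemLp (X e) 2 P) (hmean : ∀ e, ∫ ω, X e ω ∂P = 0) (hV : 0 ≤ V)
    (hXV : ∀ e, ∫ ω, X e ω ^ 2 ∂P ≤ V) {κ : ℝ} (hκ : 0 < κ) :
    P {ω | ¬HasSmallGram κ (symmMatrix fun e => X e ω)} ≤
      ENNReal.ofReal (N * V / κ) + ENNReal.ofReal (N * (N * V) ^ 2 / κ ^ 2) := by
  have := hindep.isProbabilityMeasure
  have hN : 0 < (N : ℝ) := Nat.cast_pos.2 (NeZero.pos N)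
  have hdiag := integral_sum_sum_le (fun i j => (memLp_symmMatrix hX i j).integrable_sq)
    (integral_sq_symmMatrix_le hV hXV)
  have hoff := integral_sum_sum_le
    (fun j k => (memLp_offDiagGram_symmMatrix hindep hX j k).integrable_sq)
    (integral_sq_offDiagGram_symmMatrix_le hindep hX hmean hXV)
  rw [Fintype.card_fin] at hdiag hoff
  calc _ ≤ P ({ω | N * κ ≤ ∑ i, ∑ j, symmMatrix (fun e => X e ω) i j ^ 2} ∪
        {ω | κ ^ 2 ≤ ∑ j, ∑ k, offDiagGram (symmMatrix fun e => X e ω) j k ^ 2}) := by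
        refine measure_mono fun ω hω => ?_
        by_contra hcon
        obtain ⟨hsq, hgram⟩ := not_or.1 hcon
        exact hω ⟨(not_le.1 hsq).le, (not_le.1 hgram).le⟩
    _ ≤ ENNReal.ofReal ((∫ ω, ∑ i, ∑ j, symmMatrix (fun e => X e ω) i j ^ 2 ∂P) / (N * κ)) +
        ENNReal.ofReal
          ((∫ ω, ∑ j, ∑ k, offDiagGram (symmMatrix fun e => X e ω) j k ^ 2 ∂P) / κ ^ 2) := by
        refine (measure_union_le _ _).trans (add_le_add ?_ ?_)
        · exact measure_ge_le_ofReal_integral_div (fun ω => by positivity)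
            (integrable_finsetSum _ fun i _ => integrable_finsetSum _ fun j _ =>
              (memLp_symmMatrix hX i j).integrable_sq) (by positivity)
        · exact measure_ge_le_ofReal_integral_div (fun ω => by positivity)
            (integrable_finsetSum _ fun j _ => integrable_finsetSum _ fun k _ =>
              (memLp_offDiagGram_symmMatrix hindep hX j k).integrable_sq) (by positivity)
    _ ≤ ENNReal.ofReal (N ^ 2 * V / (N * κ)) +
        ENNReal.ofReal (N ^ 2 * (N * V ^ 2) / κ ^ 2) := by gcongr
    _ = _ := by
        congr 2
        · field_simp
        · ring

end Moments

section Degrees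

variable {Ω : Type*} [MeasurableSpace Ω] {P : Measure Ω} {X : Edge N → Ω → ℝ} {θ c m : ℝ}

theorem sum_symmMatrix_row (x : Edge N → ℝ) (i : Fin N) :
    ∑ j, symmMatrix x i j = ∑ j : {j // i ≠ j}, x (edge j.2) := by
  have hzero : ∀ j : {j // ¬i ≠ j}, symmMatrix x i j = 0 := fun j => dif_neg j.2
  rw [← Fintype.sum_subtype_add_sum_subtype (fun j => i ≠ j), Fintype.sum_eq_zero _ hzero, add_zero]
  exact Finset.sum_congr rfl fun j _ => symmMatrix_of_ne x j.2

theorem edge_injective (i : Fin N) :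
    Function.Injective fun j : {j // i ≠ j} => edge j.2 := fun j k hjk => by
  have hj := j.2
  have := (edge_eq_iff j.2 k.2).1 hjk
  exact Subtype.ext (by tauto)

theorem measure_row_sum_ge_le (hindep : iIndepFun X P) (hX : ∀ e, Measurable (X e)) (hθ : 0 ≤ θ)
    (hint : ∀ e, Integrable (fun ω => Real.exp (θ * X e ω)) P) (hm : ∀ e, mgf (X e) P θ ≤ m)
    (i : Fin N) :
    P {ω | c ≤ ∑ j, symmMatrix (fun e => X e ω) i j} ≤
      ENNReal.ofReal (Real.exp (-θ * c) * m ^ (N - 1)) := by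
  have := hindep.isProbabilityMeasure
  have hrow : iIndepFun (fun j : {j // i ≠ j} => X (edge j.2)) P :=
    hindep.precomp (edge_injective i)
  have hcard : Fintype.card {j // i ≠ j} = N - 1 := by
    simp only [ne_comm (a := i), Fintype.card_subtype_compl, Fintype.card_fin, ne_eq,
      Fintype.card_unique]
  simp only [sum_symmMatrix_row, ← Finset.sum_apply]
  rw [← ofReal_measureReal]
  refine ENNReal.ofReal_le_ofReal ?_
  calc _ ≤ Real.exp (-θ * c) * mgf (∑ j : {j // i ≠ j}, X (edge j.2)) P θ :=
        measure_ge_le_exp_mul_mgf c hθ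
          (hrow.integrable_exp_mul_sum (fun j => hX _) fun j _ => hint _)
    _ ≤ Real.exp (-θ * c) * ∏ _j : {j // i ≠ j}, m := by
        rw [hrow.mgf_sum fun j => hX _]
        gcongr with j
        · exact fun j _ => mgf_nonneg
        · exact hm _
    _ = Real.exp (-θ * c) * m ^ (N - 1) := by rw [Finset.prod_const, Finset.card_univ, hcard]

theorem measure_exists_row_sum_ge_le (hindep : iIndepFun X P) (hX : ∀ e, Measurable (X e))
    (hθ : 0 ≤ θ) (hint : ∀ e, Integrable (fun ω => Real.exp (θ * X e ω)) P)
    (hm : ∀ e, mgf (X e) P θ ≤ m) :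
    P {ω | ∃ i, c ≤ ∑ j, symmMatrix (fun e => X e ω) i j} ≤
      ENNReal.ofReal (N * (Real.exp (-θ * c) * m ^ (N - 1))) := by
  rw [Set.ofPred_exists]
  calc _ ≤ ∑ _i : Fin N, ENNReal.ofReal (Real.exp (-θ * c) * m ^ (N - 1)) :=
        (measure_iUnion_fintype_le _ _).trans
          (Finset.sum_le_sum fun i _ => measure_row_sum_ge_le hindep hX hθ hint hm i)
    _ = _ := by
        rw [Finset.sum_const, Finset.card_univ, Fintype.card_fin, nsmul_eq_mul,
          ENNReal.ofReal_mul (p := (N : ℝ)) N.cast_nonneg, ENNReal.ofReal_natCast]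

end Degrees

namespace IsWeightedErdosRenyi

variable {Ω : Type*} [MeasurableSpace Ω] {P : Measure Ω} {ν : Measure ℝ} {p : ℝ}
  {w b : Edge N → Ω → ℝ}

theorem measurable_adj (hG : IsWeightedErdosRenyi P ν p w b) :
    Measurable fun ω => adj (fun e => w e ω) (fun e => b e ω) := by
  simp only [adj_eq_symmMatrix]
  exact measurable_symmMatrix.comp
    (measurable_pi_lambda _ fun e => (hG.measurable_w e).fun_mul (hG.measurable_b e))

theorem ae_mul_nonneg (hG : IsWeightedErdosRenyi P ν p w b) (hν : ∀ᵐ x ∂ν, 0 ≤ x) :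
    ∀ᵐ ω ∂P, ∀ e, 0 ≤ w e ω * b e ω := by
  refine ae_all_iff.2 fun e => ?_
  have hw : ∀ᵐ ω ∂P, 0 ≤ w e ω :=
    ae_of_ae_map (hG.measurable_w e).aemeasurable (by rwa [hG.law_w e])
  filter_upwards [hw, hG.b_zero_or_one e] with ω hw hb
  rcases hb with h | h <;> simp [h, hw]

theorem integral_b (hG : IsWeightedErdosRenyi P ν p w b) (e : Edge N) : ∫ ω, b e ω ∂P = p := by
  have hb : b e =ᵐ[P] Set.indicator {ω | b e ω = 1} 1 := by
    filter_upwards [hG.b_zero_or_one e] with ω hω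
    rcases hω with h | h <;> simp [Set.indicator, h]
  have hmeas : MeasurableSet {ω | b e ω = 1} := hG.measurable_b e (measurableSet_singleton 1)
  rw [integral_congr_ae hb, integral_indicator_one hmeas, measureReal_def, hG.prob_b,
    ENNReal.toReal_ofReal hG.p_mem.1]

theorem integrable_b (hG : IsWeightedErdosRenyi P ν p w b) (e : Edge N) : Integrable (b e) P := by
  have := hG.indep.isProbabilityMeasure
  refine Integrable.of_bound (hG.measurable_b e).aestronglyMeasurable 1 ?_
  filter_upwards [hG.b_zero_or_one e] with ω hω
  rcases hω with h | h <;> simp [h]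

section Transfer

variable {g : ℝ → ℝ}

theorem integrable_comp_w (hG : IsWeightedErdosRenyi P ν p w b) (hg : Integrable g ν)
    (e : Edge N) : Integrable (fun ω => g (w e ω)) P := by
  rw [← hG.law_w e] at hg
  exact hg.comp_measurable (hG.measurable_w e)

theorem integral_comp_w (hG : IsWeightedErdosRenyi P ν p w b) (hg : Integrable g ν)
    (e : Edge N) : ∫ ω, g (w e ω) ∂P = ∫ x, g x ∂ν := by
  rw [← hG.law_w e] at hg ⊢
  rw [integral_map (hG.measurable_w e).aemeasurable hg.1]

theorem comp_mul_ae_eq (hG : IsWeightedErdosRenyi P ν p w b) (g : ℝ → ℝ) (e : Edge N) :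
    (fun ω => g (w e ω * b e ω)) =ᵐ[P] fun ω => g 0 + (g (w e ω) - g 0) * b e ω := by
  filter_upwards [hG.b_zero_or_one e] with ω hω
  rcases hω with h | h <;> simp [h]

theorem indepFun_comp_w_b (hG : IsWeightedErdosRenyi P ν p w b) (hgm : Measurable g)
    (e : Edge N) : IndepFun (fun ω => g (w e ω) - g 0) (b e) P :=
  (hG.indep.indepFun (i := Sum.inl e) (j := Sum.inr e) (by simp)).comp
    (φ := fun x => g x - g 0) (ψ := id) (by fun_prop) measurable_id

theorem integrable_comp_mul (hG : IsWeightedErdosRenyi P ν p w b) (hgm : Measurable g)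
    (hg : Integrable g ν) (e : Edge N) : Integrable (fun ω => g (w e ω * b e ω)) P := by
  have := hG.indep.isProbabilityMeasure
  refine (Integrable.congr ?_ (hG.comp_mul_ae_eq g e).symm)
  exact (integrable_const _).add ((hG.indepFun_comp_w_b hgm e).integrable_mul
    ((hG.integrable_comp_w hg e).sub (integrable_const _)) (hG.integrable_b e))

theorem integral_comp_mul (hG : IsWeightedErdosRenyi P ν p w b) (hgm : Measurable g)
    (hg : Integrable g ν) (e : Edge N) :
    ∫ ω, g (w e ω * b e ω) ∂P = g 0 + ((∫ x, g x ∂ν) - g 0) * p := by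
  have := hG.indep.isProbabilityMeasure
  have hsub : Integrable (fun ω => g (w e ω) - g 0) P :=
    (hG.integrable_comp_w hg e).sub (integrable_const _)
  have hind := hG.indepFun_comp_w_b hgm e
  have hmul : Integrable (fun ω => (g (w e ω) - g 0) * b e ω) P :=
    hind.integrable_mul hsub (hG.integrable_b e)
  rw [integral_congr_ae (hG.comp_mul_ae_eq g e), integral_add (integrable_const _) hmul,
    hind.integral_fun_mul_eq_mul_integral hsub.1 (hG.integrable_b e).1,
    integral_sub (hG.integrable_comp_w hg e) (integrable_const _), hG.integral_comp_w hg,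
    hG.integral_b]
  simp

end Transfer

theorem iIndepFun_mul (hG : IsWeightedErdosRenyi P ν p w b) :
    iIndepFun (fun e ω => w e ω * b e ω) P :=
  iIndepFun_mul_of_sumElim hG.measurable_w hG.measurable_b hG.indep

theorem measurable_mul (hG : IsWeightedErdosRenyi P ν p w b) (e : Edge N) :
    Measurable fun ω => w e ω * b e ω :=
  (hG.measurable_w e).fun_mul (hG.measurable_b e)

theorem memLp_mul (hG : IsWeightedErdosRenyi P ν p w b) (hν : MemLp id 2 ν) (e : Edge N) :
    MemLp (fun ω => w e ω * b e ω) 2 P :=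
  (memLp_two_iff_integrable_sq (hG.measurable_mul e).aestronglyMeasurable).2
    (hG.integrable_comp_mul (g := fun x => x ^ 2) (by fun_prop) hν.integrable_sq e)

theorem integral_mul [IsFiniteMeasure ν] (hG : IsWeightedErdosRenyi P ν p w b)
    (hν : MemLp id 2 ν) (e : Edge N) : ∫ ω, w e ω * b e ω ∂P = (∫ x, x ∂ν) * p := by
  simpa using hG.integral_comp_mul (g := fun x => x) measurable_id (hν.integrable one_le_two) e

theorem integral_sq_mul (hG : IsWeightedErdosRenyi P ν p w b) (hν : MemLp id 2 ν) (e : Edge N) :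
    ∫ ω, (w e ω * b e ω) ^ 2 ∂P = (∫ x, x ^ 2 ∂ν) * p := by
  simpa using hG.integral_comp_mul (g := fun x => x ^ 2) (by fun_prop) hν.integrable_sq e

section Moments

variable [IsFiniteMeasure ν]

theorem integral_normalized_mul (hG : IsWeightedErdosRenyi P ν p w b) (hν : MemLp id 2 ν)
    (hμ : ∫ x, x ∂ν ≠ 0) (hp : p ≠ 0) (e : Edge N) :
    ∫ ω, (avgDegree N p (∫ x, x ∂ν))⁻¹ * (w e ω * b e ω) ∂P = ((N : ℝ) - 1)⁻¹ := by
  rw [integral_const_mul, hG.integral_mul hν, avgDegree, mul_comm _ p, mul_inv, mul_assoc,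
    inv_mul_cancel₀ (mul_ne_zero hp hμ), mul_one]

theorem integral_centered (hG : IsWeightedErdosRenyi P ν p w b) (hν : MemLp id 2 ν)
    (hμ : ∫ x, x ∂ν ≠ 0) (hp : p ≠ 0) (e : Edge N) :
    ∫ ω, ((avgDegree N p (∫ x, x ∂ν))⁻¹ * (w e ω * b e ω) - ((N : ℝ) - 1)⁻¹) ∂P = 0 := by
  have := hG.indep.isProbabilityMeasure
  rw [integral_sub (((hG.memLp_mul hν e).integrable one_le_two).const_mul _) (integrable_const _),
    hG.integral_normalized_mul hν hμ hp, integral_const, probReal_univ, one_smul, sub_self]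

theorem integral_sq_centered_le (hG : IsWeightedErdosRenyi P ν p w b) (hν : MemLp id 2 ν)
    (hμ : ∫ x, x ∂ν ≠ 0) (hp : p ≠ 0) (e : Edge N) :
    ∫ ω, ((avgDegree N p (∫ x, x ∂ν))⁻¹ * (w e ω * b e ω) - ((N : ℝ) - 1)⁻¹) ^ 2 ∂P ≤
      (∫ x, x ^ 2 ∂ν) * p / avgDegree N p (∫ x, x ∂ν) ^ 2 := by
  have := hG.indep.isProbabilityMeasure
  set d := avgDegree N p (∫ x, x ∂ν)
  have hmem : MemLp (fun ω => d⁻¹ * (w e ω * b e ω)) 2 P := (hG.memLp_mul hν e).const_mul _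
  calc _ = variance (fun ω => d⁻¹ * (w e ω * b e ω)) P := by
        rw [variance_eq_integral hmem.1.aemeasurable, hG.integral_normalized_mul hν hμ hp]
    _ ≤ ∫ ω, (d⁻¹ * (w e ω * b e ω)) ^ 2 ∂P := variance_le_expectation_sq hmem.1
    _ = (∫ x, x ^ 2 ∂ν) * p / d ^ 2 := by
        simp only [mul_pow]
        rw [integral_const_mul]
        simp only [← mul_pow, hG.integral_sq_mul hν]
        ring

theorem measure_not_hasSmallGram_le (hG : IsWeightedErdosRenyi P ν p w b) (hν : MemLp id 2 ν)
    (hμ : ∫ x, x ∂ν ≠ 0) (hp : p ≠ 0) (hN : 1 < N) {κ : ℝ} (hκ : 0 < κ) :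
    P {ω | ¬HasSmallGram κ (centered (avgDegree N p (∫ x, x ∂ν))
        (adj (fun e => w e ω) fun e => b e ω))} ≤
      ENNReal.ofReal (4 * (∫ x, x ^ 2 ∂ν) / (∫ x, x ∂ν) ^ 2 / (N * p) / κ) +
      ENNReal.ofReal ((4 * (∫ x, x ^ 2 ∂ν) / (∫ x, x ∂ν) ^ 2) ^ 2 / (N * p ^ 2) / κ ^ 2) := by
  have := hG.indep.isProbabilityMeasure
  have : NeZero N := ⟨by omega⟩
  have hp0 : 0 ≤ p := hG.p_mem.1
  have hN2 : (2 : ℝ) ≤ N := by exact_mod_cast hN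
  have hN1 : 0 < (N : ℝ) - 1 := by linarith
  have hrow : N * ((∫ x, x ^ 2 ∂ν) * p / avgDegree N p (∫ x, x ∂ν) ^ 2) ≤
      4 * (∫ x, x ^ 2 ∂ν) / (∫ x, x ∂ν) ^ 2 / (N * p) := by
    have hN_div : (N : ℝ) / (N - 1) ^ 2 ≤ 4 / N := by
      rw [div_le_div_iff₀ (by positivity) (by positivity)]
      nlinarith
    calc _ = (N : ℝ) / (N - 1) ^ 2 * ((∫ x, x ^ 2 ∂ν) / (∫ x, x ∂ν) ^ 2 / p) := by
          rw [avgDegree]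
          field_simp
      _ ≤ 4 / N * ((∫ x, x ^ 2 ∂ν) / (∫ x, x ∂ν) ^ 2 / p) := by gcongr
      _ = _ := by field_simp
  simp only [adj_eq_symmMatrix, centered_symmMatrix]
  refine (measure_not_hasSmallGram_symmMatrix_le
    (hG.iIndepFun_mul.comp (fun _ x => (avgDegree N p (∫ x, x ∂ν))⁻¹ * x - ((N : ℝ) - 1)⁻¹)
      fun _ => by fun_prop)
    (fun e => ((hG.memLp_mul hν e).const_mul _).sub (memLp_const _))
    (hG.integral_centered hν hμ hp) (by positivity) (hG.integral_sq_centered_le hν hμ hp)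
    hκ).trans ?_
  gcongr
  calc _ ≤ N * (4 * (∫ x, x ^ 2 ∂ν) / (∫ x, x ∂ν) ^ 2 / (N * p)) ^ 2 := by gcongr
    _ = _ := by field_simp

end Moments

/- The factor `M / (θ μ)`, where `M` is the exponential moment, is chosen so that Chernoff's bound
for the degree of a vertex is exactly `exp (-(N - 1) p)`. -/
theorem measure_exists_degree_ge_le (hG : IsWeightedErdosRenyi P ν p w b)
    (hμ : ∫ x, x ∂ν ≠ 0) {θ : ℝ} (hθ : 0 < θ)
    (hexp : Integrable (fun x => Real.exp (θ * x)) ν) (hN : 1 ≤ N) :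
    P {ω | ∃ i, (∫ x, Real.exp (θ * x) ∂ν) / (θ * ∫ x, x ∂ν) * avgDegree N p (∫ x, x ∂ν) ≤
        ∑ j, adj (fun e => w e ω) (fun e => b e ω) i j} ≤
      ENNReal.ofReal (N * Real.exp (-((N - 1) * p))) := by
  set M := ∫ x, Real.exp (θ * x) ∂ν
  have hmgf : ∀ e, mgf (fun ω => w e ω * b e ω) P θ = 1 + (M - 1) * p := fun e => by
    simpa [mgf] using hG.integral_comp_mul (g := fun x => Real.exp (θ * x)) (by fun_prop) hexp e
  have hmgf_le : 1 + (M - 1) * p ≤ Real.exp ((M - 1) * p) := by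
    rw [add_comm]
    exact Real.add_one_le_exp _
  simp only [adj_eq_symmMatrix]
  refine (measure_exists_row_sum_ge_le hG.iIndepFun_mul hG.measurable_mul hθ.le
    (fun e => hG.integrable_comp_mul (g := fun x => Real.exp (θ * x)) (by fun_prop) hexp e)
    fun e => (hmgf e).le.trans hmgf_le).trans (ENNReal.ofReal_le_ofReal ?_)
  gcongr
  rw [← Real.exp_nat_mul, ← Real.exp_add, Nat.cast_pred hN]
  refine (congrArg Real.exp ?_).le
  rw [avgDegree]
  field_simp
  ring

end IsWeightedErdosRenyi

end Graphs

section Martingale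

variable {Ω : Type*} {m0 : MeasurableSpace Ω} {μ : Measure Ω} [IsFiniteMeasure μ]
  {ℱ : Filtration ℕ m0} {f : ℕ → Ω → ℝ} {δ v : ℝ}

theorem submartingale_sq (hf : Martingale f ℱ μ) (hL2 : ∀ n, MemLp (f n) 2 μ) :
    Submartingale (fun n ω => f n ω ^ 2) ℱ μ := by
  refine submartingale_nat (fun n => (hf.stronglyAdapted n).pow 2)
    (fun n => (hL2 n).integrable_sq) fun n => ?_
  filter_upwards [(even_two.convexOn_pow (𝕜 := ℝ)).map_condExp_le_of_finiteDimensional (ℱ.le n)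
    (hf.integrable (n + 1)) (hL2 (n + 1)).integrable_sq, hf.condExp_ae_eq n.le_succ] with ω hle heq
  exact (congrArg (· ^ 2) heq).symm.le.trans hle

theorem measure_exists_abs_ge_le_of_martingale (hf : Martingale f ℱ μ)
    (hL2 : ∀ n, MemLp (f n) 2 μ) (n : ℕ) (hδ : 0 < δ) :
    μ {ω | ∃ k ≤ n, δ ≤ |f k ω|} ≤ ENNReal.ofReal ((∫ ω, f n ω ^ 2 ∂μ) / δ ^ 2) := by
  have hmax := maximal_ineq (ε := (δ ^ 2).toNNReal) (submartingale_sq hf hL2)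
    (fun k ω => sq_nonneg _) n
  rw [Real.coe_toNNReal _ (sq_nonneg δ)] at hmax
  set A := {ω | δ ^ 2 ≤
    (Finset.range (n + 1)).sup' Finset.nonempty_range_add_one fun k => f k ω ^ 2}
  have hsubset : {ω | ∃ k ≤ n, δ ≤ |f k ω|} ⊆ A := by
    rintro ω ⟨k, hk, hδk⟩
    refine le_trans (sq_le_sq.2 (by rwa [abs_of_pos hδ]))
      (Finset.le_sup' (fun k => f k ω ^ 2) (Finset.mem_range_succ_iff.2 hk))
  refine (measure_mono hsubset).trans ?_
  rw [ENNReal.ofReal_div_of_pos (by positivity), ENNReal.le_div_iff_mul_le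
    (Or.inl (by simpa using hδ.ne')) (Or.inl ENNReal.ofReal_ne_top), mul_comm]
  exact hmax.trans (ENNReal.ofReal_le_ofReal
    (setIntegral_le_integral (hL2 n).integrable_sq (Eventually.of_forall fun ω => sq_nonneg _)))

theorem integral_mul_sub_eq_zero_of_martingale (hf : Martingale f ℱ μ)
    (hL2 : ∀ n, MemLp (f n) 2 μ) (n : ℕ) : ∫ ω, f n ω * (f (n + 1) ω - f n ω) ∂μ = 0 := by
  have hsub : MemLp (f (n + 1) - f n) 2 μ := (hL2 (n + 1)).sub (hL2 n)
  have hcond : μ[f n * (f (n + 1) - f n) | ℱ n] =ᵐ[μ] 0 := by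
    filter_upwards [condExp_mul_of_stronglyMeasurable_left (hf.stronglyAdapted n)
        ((hL2 n).integrable_mul hsub) (hsub.integrable one_le_two),
      condExp_sub (hf.integrable (n + 1)) (hf.integrable n) (ℱ n),
      hf.condExp_ae_eq n.le_succ, hf.condExp_ae_eq n.le_refl] with ω hmul hdiff hsucc hself
    simp [hmul, hdiff, hsucc, hself]
  change ∫ ω, (f n * (f (n + 1) - f n)) ω ∂μ = 0
  rw [← integral_condExp (ℱ.le n), integral_congr_ae hcond]
  simp

theorem integral_sq_le_of_martingale (hf : Martingale f ℱ μ) (hL2 : ∀ n, MemLp (f n) 2 μ)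
    (hv : ∀ n, ∫ ω, (f (n + 1) ω - f n ω) ^ 2 ∂μ ≤ v) (n : ℕ) :
    ∫ ω, f n ω ^ 2 ∂μ ≤ ∫ ω, f 0 ω ^ 2 ∂μ + n * v := by
  induction n with
  | zero => simp
  | succ n ih =>
    have hsub : MemLp (fun ω => f (n + 1) ω - f n ω) 2 μ := (hL2 (n + 1)).sub (hL2 n)
    have hcross : Integrable (fun ω => 2 * (f n ω * (f (n + 1) ω - f n ω))) μ :=
      ((hL2 n).integrable_mul hsub).const_mul 2
    calc ∫ ω, f (n + 1) ω ^ 2 ∂μ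
        = ∫ ω, f n ω ^ 2 + 2 * (f n ω * (f (n + 1) ω - f n ω)) + (f (n + 1) ω - f n ω) ^ 2 ∂μ := by
          congr 1 with ω
          ring
      _ = ∫ ω, f n ω ^ 2 ∂μ + ∫ ω, (f (n + 1) ω - f n ω) ^ 2 ∂μ := by
          rw [integral_add ((hL2 n).integrable_sq.fun_add hcross) hsub.integrable_sq,
            integral_add (hL2 n).integrable_sq hcross, integral_const_mul,
            integral_mul_sub_eq_zero_of_martingale hf hL2, mul_zero, add_zero]
      _ ≤ _ := by
          push_cast
          linarith [hv n]

theorem integral_sq_sub_condExp_le {m : MeasurableSpace Ω} (hm : m ≤ m0) {X : Ω → ℝ}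
    (hX : MemLp X 2 μ) : ∫ ω, (X ω - (μ[X | m]) ω) ^ 2 ∂μ ≤ ∫ ω, X ω ^ 2 ∂μ := by
  calc _ = ∫ ω, Var[X; μ | m] ω ∂μ := (integral_condExp hm).symm
    _ ≤ ∫ ω, (μ[X ^ 2 | m]) ω ∂μ :=
        integral_mono_ae integrable_condVar integrable_condExp (condVar_ae_le_condExp_sq hm hX)
    _ = _ := integral_condExp hm

theorem measure_exists_abs_sum_sub_condExp_ge_le (hf : StronglyAdapted ℱ f)
    (hL2 : ∀ n, MemLp (f n) 2 μ) (hv : ∀ n, ∫ ω, (f (n + 1) ω - f n ω) ^ 2 ∂μ ≤ v) (n : ℕ)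
    (hδ : 0 < δ) :
    μ {ω | ∃ k ≤ n, δ ≤ |∑ i ∈ Finset.range k,
        (f (i + 1) ω - f i ω - (μ[f (i + 1) - f i | ℱ i]) ω)|} ≤
      ENNReal.ofReal (n * v / δ ^ 2) := by
  set M := martingalePart (fun k => f k - f 0) ℱ μ
  have hM : ∀ k ω, M k ω =
      ∑ i ∈ Finset.range k, (f (i + 1) ω - f i ω - (μ[f (i + 1) - f i | ℱ i]) ω) := fun k ω => by
    simp [M, martingalePart_eq_sum]
  have hM_mart : Martingale M ℱ μ := martingale_martingalePart
    (fun k => (hf k).sub ((hf 0).mono (ℱ.mono k.zero_le)))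
    fun k => ((hL2 k).sub (hL2 0)).integrable one_le_two
  have hsub : ∀ k, MemLp (f (k + 1) - f k) 2 μ := fun k => (hL2 (k + 1)).sub (hL2 k)
  have hM_L2 : ∀ k, MemLp (M k) 2 μ := fun k => by
    rw [funext (hM k)]
    exact memLp_finsetSum _ fun i _ => (hsub i).sub ((hsub i).condExp one_le_two)
  have hM_sq : ∫ ω, M n ω ^ 2 ∂μ ≤ n * v := by
    refine (integral_sq_le_of_martingale hM_mart hM_L2 (v := v) (fun k => ?_) n).trans_eq
      (by simp [hM])
    simp only [hM, Finset.sum_range_succ, add_sub_cancel_left]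
    exact (integral_sq_sub_condExp_le (ℱ.le k) (hsub k)).trans (hv k)
  simp only [← hM]
  refine (measure_exists_abs_ge_le_of_martingale hM_mart hM_L2 n hδ).trans
    (ENNReal.ofReal_le_ofReal ?_)
  gcongr

end Martingale

section Exponential

variable {n : Type*} [Fintype n] [DecidableEq n] {G : Matrix n n ℝ} {h τ : ℝ}

/-- `1 + h • G` approximates the transition matrix `exp (h • G)` up to the error `τ * h` in every
row. -/
def IsEulerStep (h τ : ℝ) (G : Matrix n n ℝ) : Prop :=
  ∀ x, ∑ y, |(NormedSpace.exp (h • G) - 1 - h • G) x y| ≤ τ * h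

theorem IsEulerStep.abs_sum_exp_mul_sub_le (hG : IsEulerStep h τ G) {g : n → ℝ}
    (hg : ∀ y, |g y| ≤ 1) {x : n} (hx : g x = 0) :
    |∑ y, NormedSpace.exp (h • G) x y * g y - h * ∑ y, G x y * g y| ≤ τ * h := by
  have hrem : ∑ y, NormedSpace.exp (h • G) x y * g y - h * ∑ y, G x y * g y =
      ∑ y, (NormedSpace.exp (h • G) - 1 - h • G) x y * g y := by
    simp [sub_mul, Finset.sum_sub_distrib, Matrix.one_apply, Finset.mul_sum, mul_assoc, hx]
  rw [hrem]
  refine (Finset.abs_sum_le_sum_abs _ _).trans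
    ((Finset.sum_le_sum fun y _ => ?_).trans (hG x))
  rw [abs_mul]
  exact mul_le_of_le_one_right (abs_nonneg _) (hg y)

attribute [local instance] Matrix.linftyOpNormedRing Matrix.linftyOpNormedAlgebra
  Matrix.linftyOpNormedAddCommGroup

theorem sum_abs_row_le_linfty_opNorm (A : Matrix n n ℝ) (x : n) : ∑ y, |A x y| ≤ ‖A‖ := by
  have hle := Finset.le_sup (f := fun x => ∑ y, ‖A x y‖₊) (Finset.mem_univ x)
  rw [Matrix.linfty_opNorm_def]
  simpa using NNReal.coe_le_coe.2 hle

theorem linfty_opNorm_le_of_forall_abs_le {B : ℝ} (hB : 0 ≤ B) (hG : ∀ x y, |G x y| ≤ B) :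
    ‖G‖ ≤ Fintype.card n * B := by
  lift B to NNReal using hB
  rw [Matrix.linfty_opNorm_def]
  refine NNReal.coe_le_coe.2 (Finset.sup_le (a := (Fintype.card n * B : NNReal)) fun x _ => ?_)
  calc ∑ y, ‖G x y‖₊ ≤ ∑ _y : n, B := Finset.sum_le_sum fun y _ => hG x y
    _ = _ := by simp

theorem eventually_isEulerStep {B : ℝ} (hB : 0 ≤ B) (hτ : 0 < τ) :
    ∀ᶠ h in 𝓝[>] (0 : ℝ), ∀ G : Matrix n n ℝ, (∀ x y, |G x y| ≤ B) → IsEulerStep h τ G := by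
  set R : ℝ := Fintype.card n * B + 1
  have hR : 0 < R := by positivity
  have hexp := hasFDerivAt_exp_zero (𝕂 := ℝ) (𝔸 := Matrix n n ℝ)
  rw [hasFDerivAt_iff_isLittleO_nhds_zero] at hexp
  obtain ⟨ε, hε, hball⟩ := Metric.eventually_nhds_iff.1 (hexp.bound (div_pos hτ hR))
  filter_upwards [Ioo_mem_nhdsGT (div_pos hε hR)] with h hh G hG x
  have hhG : ‖h • G‖ ≤ h * R := by
    rw [norm_smul, Real.norm_of_nonneg hh.1.le]
    exact mul_le_mul_of_nonneg_left
      ((linfty_opNorm_le_of_forall_abs_le hB hG).trans (lt_add_one _).le) hh.1.le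
  have hlt : dist (h • G) 0 < ε := by
    rw [dist_zero_right]
    exact hhG.trans_lt ((lt_div_iff₀ hR).1 hh.2)
  refine (sum_abs_row_le_linfty_opNorm _ x).trans ?_
  calc _ ≤ τ / R * ‖h • G‖ := by
        have hrem := hball hlt
        rw [zero_add, NormedSpace.exp_zero] at hrem
        exact hrem
    _ ≤ τ / R * (h * R) := by gcongr
    _ = τ * h := by field_simp

end Exponential

section Generator

variable {N S : ℕ} {Q : (Fin S → ℝ) → Matrix (Fin S) (Fin S) ℝ} {D : Set (Fin S → ℝ)} {d : ℝ}
  {a : Fin N → Fin N → ℝ}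

theorem forall_ne_eq_iff_update_eq {ι α : Type*} [DecidableEq ι] {f g : ι → α} {i : ι} :
    (∀ j, j ≠ i → g j = f j) ↔ Function.update f i (g i) = g := by
  simp [Function.update_eq_iff, @eq_comm _ (g _)]

theorem sum_generator_mul (g : Config N S → ℝ) (η : Config N S) :
    ∑ η', generator Q d a η η' * g η' =
      ∑ i, ∑ k, Q (environment d a (indicators η) i) k (η i) * g (Function.update η i k) := by
  simp only [generator, Finset.sum_mul, ite_mul, zero_mul, forall_ne_eq_iff_update_eq]
  rw [Finset.sum_comm]
  refine Finset.sum_congr rfl fun i _ => ?_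
  rw [← Finset.sum_filter]
  refine Finset.sum_bij' (fun η' _ => η' i) (fun k _ => Function.update η i k)
    (by simp) (by simp) (by simp) (by simp) fun η' hη' => ?_
  rw [(Finset.mem_filter.1 hη').2]

theorem density_update_sub (η : Config N S) (i : Fin N) (k s : Fin S) :
    density (Function.update η i k) s - density η s =
      (N : ℝ)⁻¹ * ((if k = s then 1 else 0) - if η i = s then 1 else 0) := by
  rw [density, density, average_apply, average_apply, ← mul_sub, ← Finset.sum_sub_distrib,
    Finset.sum_eq_single i]
  · simp [indicators]
  · intro j _ hj
    simp [indicators, Function.update_of_ne hj]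
  · simp

theorem sum_generator_mul_density_sub (hQ : IsRateFunction Q) (η : Config N S) (s : Fin S) :
    ∑ η', generator Q d a η η' * (density η' s - density η s) =
      averageDrift Q d a (indicators η) s := by
  rw [sum_generator_mul fun η' => density η' s - density η s, averageDrift, average_apply,
    Finset.mul_sum]
  refine Finset.sum_congr rfl fun i _ => ?_
  simp only [density_update_sub]
  set A := Q (environment d a (indicators η) i) with hA
  calc _ = (N : ℝ)⁻¹ * (∑ k, A k (η i) * (if k = s then 1 else 0)) -
        (N : ℝ)⁻¹ * (if η i = s then 1 else 0) * ∑ k, A k (η i) := by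
        rw [Finset.mul_sum, Finset.mul_sum, ← Finset.sum_sub_distrib]
        exact Finset.sum_congr rfl fun k _ => by ring
    _ = _ := by
        rw [hA, hQ.sum_col]
        simp [Matrix.mulVec, dotProduct, indicators]

theorem sum_generator_mul_sq_density_sub_le (η : Config N S) (s : Fin S) :
    ∑ η', generator Q d a η η' * (density η' s - density η s) ^ 2 ≤
      (N : ℝ)⁻¹ ^ 2 * ∑ i, ∑ k, |Q (environment d a (indicators η) i) k (η i)| := by
  rw [sum_generator_mul fun η' => (density η' s - density η s) ^ 2]
  simp only [Finset.mul_sum]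
  refine Finset.sum_le_sum fun i _ => Finset.sum_le_sum fun k _ => ?_
  have hsq : ((if k = s then (1 : ℝ) else 0) - if η i = s then 1 else 0) ^ 2 ≤ 1 := by
    split_ifs <;> norm_num
  rw [density_update_sub, mul_pow, mul_comm, mul_assoc]
  gcongr
  exact (mul_le_mul_of_nonneg_left (le_abs_self _) (sq_nonneg _)).trans
    (mul_le_of_le_one_left (abs_nonneg _) hsq)

theorem abs_generator_le (η η' : Config N S) :
    |generator Q d a η η'| ≤ ∑ i, |Q (environment d a (indicators η) i) (η' i) (η i)| := by
  refine (Finset.abs_sum_le_sum_abs _ _).trans (Finset.sum_le_sum fun i _ => ?_)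
  split_ifs
  · exact le_rfl
  · simp

end Generator

section Recursion

variable {E : Type*} [NormedAddCommGroup E] [NormedSpace ℝ E]
  {x u D : ℕ → E} {F : E → E} {h K ε δ₀ δ₁ : ℝ} {n : ℕ}

theorem norm_sub_le_of_discrete_recursion (hh : 0 ≤ h) (hK : 0 ≤ K) (hε : 0 ≤ ε)
    (hx : ∀ k < n, ‖x (k + 1) - x k - D k - h • F (x k)‖ ≤ h * ε)
    (hu : ∀ k < n, ‖u (k + 1) - u k - h • F (u k)‖ ≤ h * ε)
    (hF : ∀ k < n, ‖F (x k) - F (u k)‖ ≤ K * ‖x k - u k‖)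
    (hD : ∀ k ≤ n, ‖∑ j ∈ Finset.range k, D j‖ ≤ δ₁) (h0 : ‖x 0 - u 0‖ ≤ δ₀)
    {k : ℕ} (hk : k ≤ n) :
    ‖x k - u k‖ ≤ (δ₀ + δ₁ + k * h * (2 * ε)) * (1 + h * K) ^ k := by
  -- removing the accumulated noise from the error leaves a quantity with small increments
  set y : ℕ → E := fun k => x k - u k - ∑ j ∈ Finset.range k, D j with hy
  have hxy : ∀ k ≤ n, ‖x k - u k‖ ≤ ‖y k‖ + δ₁ := fun k hk => by
    rw [← sub_add_cancel (x k - u k) (∑ j ∈ Finset.range k, D j)]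
    exact (norm_add_le _ _).trans (by gcongr; exact hD k hk)
  suffices key : ‖y k‖ + δ₁ ≤ (δ₀ + δ₁ + k * h * (2 * ε)) * (1 + h * K) ^ k from
    (hxy k hk).trans key
  induction k with
  | zero => simpa [hy] using h0
  | succ k ih =>
    have hstep : y (k + 1) = y k + (x (k + 1) - x k - D k - h • F (x k)) -
        (u (k + 1) - u k - h • F (u k)) + h • (F (x k) - F (u k)) := by
      simp only [hy, Finset.sum_range_succ, smul_sub]
      abel
    have hFk : ‖h • (F (x k) - F (u k))‖ ≤ h * (K * (‖y k‖ + δ₁)) := by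
      rw [norm_smul, Real.norm_of_nonneg hh]
      gcongr
      exact (hF k hk).trans (by gcongr; exact hxy k (Nat.le_of_succ_le hk))
    have hyk : ‖y (k + 1)‖ ≤ ‖y k‖ + h * ε + h * ε + h * (K * (‖y k‖ + δ₁)) := by
      rw [hstep]
      exact norm_add_le_of_le (norm_sub_le_of_le (norm_add_le_of_le le_rfl (hx k hk)) (hu k hk)) hFk
    have hone : 1 ≤ (1 + h * K) ^ (k + 1) :=
      one_le_pow₀ (le_add_of_nonneg_right (mul_nonneg hh hK))
    calc ‖y (k + 1)‖ + δ₁ ≤ (1 + h * K) * (‖y k‖ + δ₁) + h * (2 * ε) * 1 := by linarith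
      _ ≤ (1 + h * K) * ((δ₀ + δ₁ + k * h * (2 * ε)) * (1 + h * K) ^ k) +
          h * (2 * ε) * (1 + h * K) ^ (k + 1) := by
          gcongr
          exact ih (Nat.le_of_succ_le hk)
      _ = _ := by push_cast; ring

theorem one_add_mul_pow_le_exp (hh : 0 ≤ h) (hK : 0 ≤ K) {k : ℕ} (hk : k ≤ n) :
    (1 + h * K) ^ k ≤ Real.exp (K * (n * h)) := by
  calc (1 + h * K) ^ k ≤ Real.exp (h * K) ^ k := by
        gcongr
        linarith [Real.add_one_le_exp (h * K)]
    _ = Real.exp (k * (h * K)) := (Real.exp_nat_mul _ _).symm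
    _ ≤ Real.exp (n * (h * K)) := by gcongr
    _ = _ := by ring_nf

end Recursion

section History

variable {Ω : Type*} {N S : ℕ} {a : Ω → Fin N → Fin N → ℝ} {ξ : ℝ → Ω → Config N S}
  {𝒜 : Set (Fin N → Fin N → ℝ)} {r t : ℝ}

theorem history_mono (a : Ω → Fin N → Fin N → ℝ) (ξ : ℝ → Ω → Config N S) :
    Monotone (history a ξ) := fun _ t hrt =>
  sup_le_sup_left (iSup₂_le fun q hq =>
    le_iSup₂_of_le (f := fun q (_ : q ∈ Set.Icc (0 : ℝ) t) =>
      MeasurableSpace.comap (ξ q) inferInstance) q ⟨hq.1, hq.2.trans hrt⟩ le_rfl) _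

theorem measurable_history (ht : 0 ≤ t) : Measurable[history a ξ t] (ξ t) :=
  (comap_measurable (ξ t)).mono
    (le_sup_of_le_right (le_iSup₂_of_le (f := fun q (_ : q ∈ Set.Icc (0 : ℝ) t) =>
      MeasurableSpace.comap (ξ q) inferInstance) t ⟨ht, le_rfl⟩ le_rfl)) le_rfl

theorem stronglyMeasurable_history_indicator (h𝒜 : MeasurableSet 𝒜) (g : Config N S → ℝ)
    (ht : 0 ≤ t) :
    StronglyMeasurable[history a ξ t] ((a ⁻¹' 𝒜).indicator fun ω => g (ξ t ω)) := by
  refine StronglyMeasurable.indicator ?_ ((le_sup_left : _ ≤ history a ξ t) _ ⟨𝒜, h𝒜, rfl⟩)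
  exact ((Measurable.of_discrete (f := g)).comp (measurable_history ht)).stronglyMeasurable

variable {mΩ : MeasurableSpace Ω} {P : Measure Ω}

theorem history_le (ha : Measurable a) (hξ : ∀ t, 0 ≤ t → Measurable (ξ t)) (t : ℝ) :
    history a ξ t ≤ mΩ :=
  sup_le ha.comap_le (iSup₂_le fun q hq => (hξ q hq.1).comap_le)

theorem memLp_indicator [IsFiniteMeasure P] (ha : Measurable a) (h𝒜 : MeasurableSet 𝒜)
    (hξ : ∀ t, 0 ≤ t → Measurable (ξ t)) (g : Config N S → ℝ) (ht : 0 ≤ t) (q : ℝ≥0∞) :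
    MemLp ((a ⁻¹' 𝒜).indicator fun ω => g (ξ t ω)) q P := by
  refine MemLp.of_bound ((stronglyMeasurable_history_indicator h𝒜 g ht).mono
    (history_le ha hξ t)).aestronglyMeasurable ‖g‖ (Eventually.of_forall fun ω => ?_)
  exact (norm_indicator_le_norm_self _ _).trans (norm_le_pi_norm g _)

variable {Q : (Fin S → ℝ) → Matrix (Fin S) (Fin S) ℝ} {d : ℝ}

theorem indicator_apply_eq_sum (𝒜 : Set (Fin N → Fin N → ℝ)) (g : Config N S → Config N S → ℝ)
    (r t : ℝ) :
    (a ⁻¹' 𝒜).indicator (fun ω => g (ξ r ω) (ξ t ω)) = ∑ η,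
      (a ⁻¹' 𝒜).indicator (fun ω => g (ξ r ω) η) * {ω | ξ t ω = η}.indicator fun _ => (1 : ℝ) := by
  ext ω
  rw [Finset.sum_apply, Finset.sum_eq_single (ξ t ω)]
  · by_cases hω : ω ∈ a ⁻¹' 𝒜 <;> simp [hω]
  · intro η _ hne
    simp [hne.symm]
  · simp

theorem IsLocalDensityProcess.condExp_indicator [IsFiniteMeasure P]
    (hξ : IsLocalDensityProcess P Q d a ξ) (ha : Measurable a) (h𝒜 : MeasurableSet 𝒜)
    (g : Config N S → Config N S → ℝ) (hr : 0 ≤ r) (hrt : r ≤ t) :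
    P[(a ⁻¹' 𝒜).indicator (fun ω => g (ξ r ω) (ξ t ω)) | history a ξ r] =ᵐ[P]
      (a ⁻¹' 𝒜).indicator fun ω =>
        ∑ η, NormedSpace.exp ((t - r) • generator Q d (a ω)) (ξ r ω) η * g (ξ r ω) η := by
  have hX : ∀ η, Integrable ({ω | ξ t ω = η}.indicator fun _ => (1 : ℝ)) P := fun η =>
    (integrable_const 1).indicator (hξ.measurable t (hr.trans hrt) (measurableSet_singleton η))
  have hmul : ∀ η, Integrable ((a ⁻¹' 𝒜).indicator (fun ω => g (ξ r ω) η) *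
      {ω | ξ t ω = η}.indicator fun _ => (1 : ℝ)) P := fun η =>
    (hX η).bdd_mul (c := ‖fun η' => g η' η‖)
      (memLp_indicator ha h𝒜 hξ.measurable (g · η) hr 1).aestronglyMeasurable
      (Eventually.of_forall fun ω =>
        (norm_indicator_le_norm_self _ _).trans (norm_le_pi_norm (g · η) _))
  have hterm : ∀ᵐ ω ∂P, ∀ η, (P[(a ⁻¹' 𝒜).indicator (fun ω => g (ξ r ω) η) *
      {ω | ξ t ω = η}.indicator fun _ => (1 : ℝ) | history a ξ r]) ω =
      (a ⁻¹' 𝒜).indicator (fun ω => g (ξ r ω) η) ω *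
        NormedSpace.exp ((t - r) • generator Q d (a ω)) (ξ r ω) η := by
    refine ae_all_iff.2 fun η => ?_
    filter_upwards [condExp_mul_of_stronglyMeasurable_left
      (stronglyMeasurable_history_indicator h𝒜 (g · η) hr) (hmul η) (hX η),
      hξ.markov r t hr hrt η] with ω hpull hmarkov
    rw [hpull, Pi.mul_apply, hmarkov]
  rw [indicator_apply_eq_sum]
  filter_upwards [condExp_finsetSum (s := Finset.univ) (fun η _ => hmul η) (history a ξ r), hterm]
    with ω hsum hω
  rw [hsum, Finset.sum_apply]
  simp only [hω]
  by_cases hmem : ω ∈ a ⁻¹' 𝒜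
  · simp only [Set.indicator_of_mem hmem, mul_comm]
  · simp [Set.indicator_of_notMem hmem]

end History

section Step

variable {N S : ℕ} {Q : (Fin S → ℝ) → Matrix (Fin S) (Fin S) ℝ} {D : Set (Fin S → ℝ)}
  {d r h τ δ : ℝ} {a : Fin N → Fin N → ℝ} {L B : NNReal} {u : ℝ → Fin S → ℝ}

theorem IsWellMixed.nonneg_radius (ha : IsWellMixed D d r a) (η : Config N S) : 0 ≤ r :=
  (deviation_nonneg d a _).trans (ha.deviation_le _ (indicators_mem_stdSimplex η))

variable [NeZero N]

theorem abs_density_sub_le_one (η η' : Config N S) (s : Fin S) :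
    |density η' s - density η s| ≤ 1 := by
  have hη := abs_le_one_of_mem_stdSimplex (density_mem_stdSimplex η) s
  have hη' := abs_le_one_of_mem_stdSimplex (density_mem_stdSimplex η') s
  rw [abs_of_nonneg ((density_mem_stdSimplex _).1 s)] at hη hη'
  rw [abs_le]
  constructor <;> linarith [(density_mem_stdSimplex η).1 s, (density_mem_stdSimplex η').1 s]

/-- The expected increment of the density during a time step `h` of the Markov chain on the graph
`a` that starts from `η`. -/
noncomputable def meanIncrement (Q : (Fin S → ℝ) → Matrix (Fin S) (Fin S) ℝ) (d : ℝ)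
    (a : Fin N → Fin N → ℝ) (h : ℝ) (η : Config N S) : Fin S → ℝ := fun s =>
  ∑ η', NormedSpace.exp (h • generator Q d a) η η' * (density η' s - density η s)

namespace IsWellMixed

theorem abs_generator_le (ha : IsWellMixed D d r a) (hb : RateBounds Q D L B)
    (η η' : Config N S) : |generator Q d a η η'| ≤ N * (B + L * r) :=
  (MeanField.abs_generator_le η η').trans
    (ha.sum_abs_rate_le hb (indicators_mem_stdSimplex η) η' η)

theorem norm_meanIncrement_sub_le (ha : IsWellMixed D d r a) (hb : RateBounds Q D L B)
    (hQ : IsRateFunction Q) (hG : IsEulerStep h τ (generator Q d a)) (hh : 0 ≤ h) (hτ : 0 ≤ τ)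
    (η : Config N S) :
    ‖meanIncrement Q d a h η - h • (Q (density η) *ᵥ density η)‖ ≤ h * (S * L * r + τ) := by
  have heuler : ‖meanIncrement Q d a h η - h • averageDrift Q d a (indicators η)‖ ≤ τ * h := by
    refine (pi_norm_le_iff_of_nonneg (by positivity)).2 fun s => ?_
    rw [Pi.sub_apply, Pi.smul_apply, smul_eq_mul, ← sum_generator_mul_density_sub hQ]
    exact hG.abs_sum_exp_mul_sub_le (fun η' => abs_density_sub_le_one η η' s) (sub_self _)
  have hdrift := ha.norm_averageDrift_sub_le hb (indicators_mem_stdSimplex η)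
  calc _ ≤ ‖meanIncrement Q d a h η - h • averageDrift Q d a (indicators η)‖ +
        ‖h • averageDrift Q d a (indicators η) - h • (Q (density η) *ᵥ density η)‖ :=
        norm_sub_le_norm_sub_add_norm_sub _ _ _
    _ ≤ τ * h + h * (S * L * r) := by
        rw [← smul_sub, norm_smul, Real.norm_of_nonneg hh]
        gcongr
    _ = _ := by ring

theorem sum_exp_mul_sq_density_sub_le (ha : IsWellMixed D d r a) (hb : RateBounds Q D L B)
    (hG : IsEulerStep h τ (generator Q d a)) (hh : 0 ≤ h) (η : Config N S) (s : Fin S) :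
    ∑ η', NormedSpace.exp (h • generator Q d a) η η' * (density η' s - density η s) ^ 2 ≤
      h * (S * (B + L * r) / N + τ) := by
  have heuler := hG.abs_sum_exp_mul_sub_le (x := η)
    (g := fun η' => (density η' s - density η s) ^ 2)
    (fun η' => by
      rw [abs_pow]
      exact pow_le_one₀ (abs_nonneg _) (abs_density_sub_le_one η η' s)) (by simp)
  have hrate : ∑ i, ∑ k, |Q (environment d a (indicators η) i) k (η i)| ≤
      S * (N * (B + L * r)) := by
    rw [Finset.sum_comm]
    refine (Finset.sum_le_sum fun k _ =>
      ha.sum_abs_rate_le hb (indicators_mem_stdSimplex η) (fun _ => k) η).trans_eq (by simp)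
  have hquad : ∑ η', generator Q d a η η' * (density η' s - density η s) ^ 2 ≤
      S * (B + L * r) / N := by
    refine (sum_generator_mul_sq_density_sub_le η s).trans
      ((mul_le_mul_of_nonneg_left hrate (by positivity)).trans_eq ?_)
    have hN : (N : ℝ) ≠ 0 := NeZero.ne _
    field_simp
  linarith [(abs_le.1 heuler).2, mul_le_mul_of_nonneg_left hquad hh]

-- The accumulated noise is a martingale along the Markov chain; what remains is an Euler scheme.
theorem norm_density_sub_le (ha : IsWellMixed D d r a) (hb : RateBounds Q D L B)
    (hQ : IsRateFunction Q) (hQlip : ∀ k s, LocallyLipschitz fun φ => Q φ k s)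
    (hu : IsMeanFieldSolution Q u) (hG : IsEulerStep h τ (generator Q d a)) (hh : 0 ≤ h)
    (hτ : S * (L + B) * (S * B) * h ≤ τ) {n : ℕ} {η : ℕ → Config N S}
    (h0 : ‖density (η 0) - u 0‖ ≤ δ)
    (hnoise : ∀ k ≤ n, ‖∑ j ∈ Finset.range k, (density (η (j + 1)) - density (η j) -
      meanIncrement Q d a h (η j))‖ ≤ δ) {k : ℕ} (hk : k ≤ n) :
    ‖density (η k) - u (k * h)‖ ≤
      (2 * δ + n * h * (2 * (S * L * r + τ))) * Real.exp (S * (L + B) * (n * h)) := by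
  have hr : 0 ≤ r := ha.nonneg_radius (η 0)
  have hτ0 : 0 ≤ τ := le_trans (by positivity) hτ
  have hδ : 0 ≤ δ := (norm_nonneg _).trans h0
  have hrec := norm_sub_le_of_discrete_recursion (n := n) (ε := S * L * r + τ)
    (x := fun k => density (η k)) (u := fun k => u (k * h)) (F := fun v => Q v *ᵥ v) hh
    (by positivity : (0 : ℝ) ≤ S * (L + B)) (by positivity) (fun j _ => by
      simpa only [sub_sub_cancel] using ha.norm_meanIncrement_sub_le hb hQ hG hh hτ0 (η j))
    (fun j _ => by
      rw [Nat.cast_succ, add_one_mul]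
      refine (hu.norm_eulerStep_le hQ hQlip hb (by positivity) hh).trans ?_
      rw [mul_comm h]
      gcongr
      exact hτ.trans (le_add_of_nonneg_left (by positivity)))
    (fun j _ => hb.norm_drift_sub_le (density_mem_stdSimplex _)
      (hu.mem_stdSimplex hQ hQlip (by positivity)))
    hnoise (by simpa using h0) hk
  refine hrec.trans ?_
  rw [← two_mul]
  gcongr
  exact one_add_mul_pow_le_exp hh (by positivity) hk

end IsWellMixed

end Step

section Grid

variable {Ω : Type*} {mΩ : MeasurableSpace Ω} {P : Measure Ω} {N S : ℕ}
  {Q : (Fin S → ℝ) → Matrix (Fin S) (Fin S) ℝ} {D : Set (Fin S → ℝ)} {d r h τ δ : ℝ}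
  {a : Ω → Fin N → Fin N → ℝ} {ξ : ℝ → Ω → Config N S} {𝒜 : Set (Fin N → Fin N → ℝ)}
  {L B : NNReal} {u : ℝ → Fin S → ℝ}

/-- The filtration of the graph and the process up to the grid points `k * h`. -/
def gridFiltration (ha : Measurable a) (hξ : ∀ t, 0 ≤ t → Measurable (ξ t)) (hh : 0 ≤ h) :
    Filtration ℕ mΩ where
  seq k := history a ξ (k * h)
  mono' _ _ hkl := history_mono a ξ (by gcongr)
  le' _ := history_le ha hξ _

/-- The density of the state `s` along the grid points `k * h`, set to zero off the event that the
graph lies in `𝒜`. -/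
noncomputable def gridDensity (a : Ω → Fin N → Fin N → ℝ) (ξ : ℝ → Ω → Config N S)
    (𝒜 : Set (Fin N → Fin N → ℝ)) (h : ℝ) (s : Fin S) (k : ℕ) : Ω → ℝ :=
  (a ⁻¹' 𝒜).indicator fun ω => density (ξ (k * h) ω) s

theorem gridDensity_succ_sub (s : Fin S) (k : ℕ) :
    gridDensity a ξ 𝒜 h s (k + 1) - gridDensity a ξ 𝒜 h s k = (a ⁻¹' 𝒜).indicator fun ω =>
      density (ξ (k * h + h) ω) s - density (ξ (k * h) ω) s := by
  rw [gridDensity, gridDensity, Nat.cast_succ, add_one_mul]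
  exact (Set.indicator_sub (a ⁻¹' 𝒜) (fun ω => density (ξ (k * h + h) ω) s) _).symm

theorem stronglyAdapted_gridDensity (ha : Measurable a) (h𝒜 : MeasurableSet 𝒜)
    (hξ : ∀ t, 0 ≤ t → Measurable (ξ t)) (hh : 0 ≤ h) (s : Fin S) :
    StronglyAdapted (gridFiltration ha hξ hh) (gridDensity a ξ 𝒜 h s) := fun k =>
  stronglyMeasurable_history_indicator h𝒜 (density · s) (by positivity)

namespace IsLocalDensityProcess

theorem condExp_gridDensity_succ_sub [IsFiniteMeasure P] (hξ : IsLocalDensityProcess P Q d a ξ)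
    (ha : Measurable a) (h𝒜 : MeasurableSet 𝒜) (hh : 0 ≤ h) (s : Fin S) (k : ℕ) :
    P[gridDensity a ξ 𝒜 h s (k + 1) - gridDensity a ξ 𝒜 h s k | history a ξ (k * h)] =ᵐ[P]
      (a ⁻¹' 𝒜).indicator fun ω => meanIncrement Q d (a ω) h (ξ (k * h) ω) s := by
  have hcond := hξ.condExp_indicator ha h𝒜 (fun η η' => density η' s - density η s)
    (by positivity : 0 ≤ k * h) (le_add_of_nonneg_right hh)
  rw [gridDensity_succ_sub]
  simpa only [add_sub_cancel_left, meanIncrement] using hcond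

theorem ae_gridDensity_succ_sub_sub_condExp_eq [IsFiniteMeasure P]
    (hξ : IsLocalDensityProcess P Q d a ξ)
    (ha : Measurable a) (h𝒜 : MeasurableSet 𝒜) (hh : 0 ≤ h) :
    ∀ᵐ ω ∂P, a ω ∈ 𝒜 → ∀ (s : Fin S) (k : ℕ),
      gridDensity a ξ 𝒜 h s (k + 1) ω - gridDensity a ξ 𝒜 h s k ω -
          (P[gridDensity a ξ 𝒜 h s (k + 1) - gridDensity a ξ 𝒜 h s k | history a ξ (k * h)]) ω =
        (density (ξ ((k + 1 : ℕ) * h) ω) - density (ξ (k * h) ω) -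
          meanIncrement Q d (a ω) h (ξ (k * h) ω)) s := by
  filter_upwards [ae_all_iff.2 fun s => ae_all_iff.2 fun k =>
    hξ.condExp_gridDensity_succ_sub ha h𝒜 hh s k] with ω hω hA s k
  have hmem : ω ∈ a ⁻¹' 𝒜 := hA
  rw [hω s k]
  simp [gridDensity, hmem]

variable [NeZero N] [IsProbabilityMeasure P]

theorem integral_sq_gridDensity_succ_sub_le (hξ : IsLocalDensityProcess P Q d a ξ)
    (ha : Measurable a) (h𝒜 : MeasurableSet 𝒜) (hmix : ∀ a ∈ 𝒜, IsWellMixed D d r a)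
    (hb : RateBounds Q D L B) (hG : ∀ a ∈ 𝒜, IsEulerStep h τ (generator Q d a)) (hh : 0 ≤ h)
    (hr : 0 ≤ r) (hτ : 0 ≤ τ) (s : Fin S) (k : ℕ) :
    ∫ ω, (gridDensity a ξ 𝒜 h s (k + 1) ω - gridDensity a ξ 𝒜 h s k ω) ^ 2 ∂P ≤
      h * (S * (B + L * r) / N + τ) := by
  have hsq : ∀ ω, (gridDensity a ξ 𝒜 h s (k + 1) ω - gridDensity a ξ 𝒜 h s k ω) ^ 2 =
      (a ⁻¹' 𝒜).indicator
        (fun ω => (density (ξ (k * h + h) ω) s - density (ξ (k * h) ω) s) ^ 2) ω := fun ω => by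
    rw [← Pi.sub_apply, gridDensity_succ_sub]
    by_cases hω : ω ∈ a ⁻¹' 𝒜 <;> simp [hω]
  have hcond := hξ.condExp_indicator ha h𝒜 (fun η η' => (density η' s - density η s) ^ 2)
    (by positivity : 0 ≤ k * h) (le_add_of_nonneg_right hh)
  simp only [hsq, add_sub_cancel_left] at hcond ⊢
  rw [← integral_condExp (history_le ha hξ.measurable (k * h))]
  calc _ ≤ ∫ _ω, h * (S * (B + L * r) / N + τ) ∂P := by
        refine integral_mono_ae integrable_condExp (integrable_const _) ?_
        filter_upwards [hcond] with ω hω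
        rw [hω]
        refine Set.indicator_apply_le' (fun hmem => ?_) fun _ => by positivity
        exact (hmix _ hmem).sum_exp_mul_sq_density_sub_le hb (hG _ hmem) hh _ s
    _ = _ := by simp

theorem measure_exists_grid_lt_le (hξ : IsLocalDensityProcess P Q d a ξ) (ha : Measurable a)
    (h𝒜 : MeasurableSet 𝒜) (hmix : ∀ a ∈ 𝒜, IsWellMixed D d r a) (hb : RateBounds Q D L B)
    (hQ : IsRateFunction Q) (hQlip : ∀ k s, LocallyLipschitz fun φ => Q φ k s)
    (hu : IsMeanFieldSolution Q u) (hG : ∀ a ∈ 𝒜, IsEulerStep h τ (generator Q d a)) (hh : 0 ≤ h)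
    (hr : 0 ≤ r) (hτ : S * (L + B) * (S * B) * h ≤ τ) (n : ℕ) (hδ : 0 < δ) :
    P {ω | a ω ∈ 𝒜 ∧ ‖density (ξ 0 ω) - u 0‖ ≤ δ ∧ ∃ k ≤ n,
        (2 * δ + n * h * (2 * (S * L * r + τ))) * Real.exp (S * (L + B) * (n * h)) <
          ‖density (ξ (k * h) ω) - u (k * h)‖} ≤
      S * ENNReal.ofReal (n * (h * (S * (B + L * r) / N + τ)) / δ ^ 2) := by
  set f := gridDensity a ξ 𝒜 h
  set bad : Fin S → Set Ω := fun s => {ω | ∃ k ≤ n, δ ≤ |∑ j ∈ Finset.range k,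
    (f s (j + 1) ω - f s j ω - (P[f s (j + 1) - f s j | history a ξ (j * h)]) ω)|}
  have hbad : ∀ s, P (bad s) ≤ ENNReal.ofReal (n * (h * (S * (B + L * r) / N + τ)) / δ ^ 2) :=
    fun s => measure_exists_abs_sum_sub_condExp_ge_le
      (stronglyAdapted_gridDensity ha h𝒜 hξ.measurable hh s)
      (fun k => memLp_indicator ha h𝒜 hξ.measurable (density · s) (by positivity) 2)
      (hξ.integral_sq_gridDensity_succ_sub_le ha h𝒜 hmix hb hG hh hr
        (le_trans (by positivity) hτ) s) n hδ
  have hsubset : ∀ᵐ ω ∂P, (a ω ∈ 𝒜 ∧ ‖density (ξ 0 ω) - u 0‖ ≤ δ ∧ ∃ k ≤ n,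
      (2 * δ + n * h * (2 * (S * L * r + τ))) * Real.exp (S * (L + B) * (n * h)) <
        ‖density (ξ (k * h) ω) - u (k * h)‖) → ω ∈ ⋃ s, bad s := by
    filter_upwards [hξ.ae_gridDensity_succ_sub_sub_condExp_eq ha h𝒜 hh]
      with ω hω ⟨hA, h0, k, hk, hlt⟩
    by_contra hgood
    refine hlt.not_ge ((hmix _ hA).norm_density_sub_le hb hQ hQlip hu (hG _ hA) hh hτ
      (η := fun k => ξ (k * h) ω) (by simpa using h0) (fun k hk => ?_) hk)
    refine (pi_norm_le_iff_of_nonneg hδ.le).2 fun s => ?_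
    rw [Finset.sum_apply, ← Finset.sum_congr rfl fun j _ => hω hA s j]
    exact le_of_not_ge fun hle => hgood (Set.mem_iUnion.2 ⟨s, k, hk, hle⟩)
  calc _ ≤ P (⋃ s, bad s) := measure_mono_ae hsubset
    _ ≤ ∑ s, P (bad s) := measure_iUnion_fintype_le _ _
    _ ≤ ∑ _s : Fin S, ENNReal.ofReal (n * (h * (S * (B + L * r) / N + τ)) / δ ^ 2) :=
        Finset.sum_le_sum fun s _ => hbad s
    _ = _ := by simp

end IsLocalDensityProcess

end Grid

section ContinuousTime

theorem exists_dyadic_of_eventually {p : ℝ → Prop} {T t : ℝ} (hT : 0 < T) (ht : t ∈ Set.Icc 0 T)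
    (hp : p t) (hev : ∀ᶠ r in 𝓝[>] t, p r) : ∃ m k : ℕ, k ≤ 2 ^ m ∧ p (k * (T / 2 ^ m)) := by
  rcases ht.2.eq_or_lt with rfl | htT
  · exact ⟨0, 1, by simp, by simpa using hp⟩
  obtain ⟨t', ht', hsub⟩ := mem_nhdsGT_iff_exists_Ioo_subset.1
    (inter_mem hev (Ioo_mem_nhdsGT htT))
  obtain ⟨m, hm⟩ := pow_unbounded_of_one_lt (T / (t' - t)) one_lt_two
  have hpow : (0 : ℝ) < 2 ^ m := by positivity
  have hstep : 0 < T / 2 ^ m := by positivity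
  have hfine : T / 2 ^ m < t' - t := by
    rwa [div_lt_comm₀ (sub_pos.2 ht') hpow] at hm
  have hfloor := (le_div_iff₀ hstep).1 (Nat.floor_le (div_nonneg ht.1 hstep.le))
  have hceil := (div_lt_iff₀ hstep).1 (Nat.lt_floor_add_one (t / (T / 2 ^ m)))
  set k := ⌊t / (T / 2 ^ m)⌋₊
  obtain ⟨hpk, -, hkT⟩ := hsub (a := (k + 1 : ℕ) * (T / 2 ^ m))
    ⟨by exact_mod_cast hceil, by push_cast; linarith⟩
  refine ⟨m, k + 1, ?_, hpk⟩
  rw [mul_div_left_comm, mul_lt_iff_lt_one_right hT, div_lt_one hpow] at hkT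
  exact_mod_cast hkT.le

theorem measure_exists_mem_Icc_le_of_dyadic {Ω : Type*} {mΩ : MeasurableSpace Ω} {P : Measure Ω}
    {p : ℝ → Ω → Prop} {T : ℝ} {c : ℝ≥0∞} (hT : 0 < T)
    (hright : ∀ᵐ ω ∂P, ∀ t, 0 ≤ t → p t ω → ∀ᶠ r in 𝓝[>] t, p r ω)
    (hdyadic : ∀ᶠ m : ℕ in atTop, P {ω | ∃ k : ℕ, k ≤ 2 ^ m ∧ p (k * (T / 2 ^ m)) ω} ≤ c) :
    P {ω | ∃ t ∈ Set.Icc 0 T, p t ω} ≤ c := by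
  set A : ℕ → Set Ω := fun m => {ω | ∃ k : ℕ, k ≤ 2 ^ m ∧ p (k * (T / 2 ^ m)) ω}
  have hmono : Monotone A := by
    refine monotone_nat_of_le_succ fun m ω ⟨k, hk, hpk⟩ => ⟨2 * k, by rw [pow_succ]; omega, ?_⟩
    convert hpk using 1
    push_cast
    field_simp
    ring
  have hsub : ∀ᵐ ω ∂P, (∃ t ∈ Set.Icc 0 T, p t ω) → ω ∈ ⋃ m, A m := by
    filter_upwards [hright] with ω hω ⟨t, ht, hpt⟩
    exact Set.mem_iUnion.2 (exists_dyadic_of_eventually hT ht hpt (hω t ht.1 hpt))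
  calc _ ≤ P (⋃ m, A m) := measure_mono_ae hsub
    _ ≤ c := le_of_tendsto (tendsto_measure_iUnion_atTop hmono) hdyadic

theorem isClosed_setOf_isWellMixed {N S : ℕ} {D : Set (Fin S → ℝ)} (hD : IsClosed D) (d r : ℝ) :
    IsClosed {a : Fin N → Fin N → ℝ | IsWellMixed D d r a} := by
  have henv : ∀ (v : Fin N → Fin S → ℝ) i,
      Continuous fun a : Fin N → Fin N → ℝ => environment d a v i := fun v i => by
    unfold environment
    fun_prop
  have hdev : ∀ v : Fin N → Fin S → ℝ,
      Continuous fun a : Fin N → Fin N → ℝ => deviation d a v := fun v =>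
    continuous_const.mul (continuous_finsetSum _ fun i _ => ((henv v i).sub continuous_const).norm)
  have heq : {a : Fin N → Fin N → ℝ | IsWellMixed D d r a} = {a | ∀ i j, 0 ≤ a i j} ∩
      {a | ∀ v : Fin N → Fin S → ℝ, (∀ i, v i ∈ stdSimplex ℝ (Fin S)) →
        ∀ i, environment d a v i ∈ D} ∩
      {a | ∀ v : Fin N → Fin S → ℝ, (∀ i, v i ∈ stdSimplex ℝ (Fin S)) → deviation d a v ≤ r} :=
    Set.ext fun a => ⟨fun h => ⟨⟨h.1, h.2⟩, h.3⟩, fun h => ⟨h.1.1, h.1.2, h.2⟩⟩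
  rw [heq]
  simp only [Set.ofPred_forall]
  exact ((isClosed_iInter fun i => isClosed_iInter fun j =>
      isClosed_le continuous_const (by fun_prop)).inter
    (isClosed_iInter fun v => isClosed_iInter fun _ => isClosed_iInter fun i =>
      hD.preimage (henv v i))).inter
    (isClosed_iInter fun v => isClosed_iInter fun _ => isClosed_le (hdev v) continuous_const)

variable {Ω : Type*} {mΩ : MeasurableSpace Ω} {P : Measure Ω} {N S : ℕ}
  {Q : (Fin S → ℝ) → Matrix (Fin S) (Fin S) ℝ} {D : Set (Fin S → ℝ)} {d r δ ε T : ℝ}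
  {a : Ω → Fin N → Fin N → ℝ} {ξ : ℝ → Ω → Config N S} {L B : NNReal} {u : ℝ → Fin S → ℝ}

namespace IsLocalDensityProcess

theorem ae_eventually_lt_norm_density_sub (hξ : IsLocalDensityProcess P Q d a ξ)
    (hu : IsMeanFieldSolution Q u) :
    ∀ᵐ ω ∂P, ∀ t, 0 ≤ t → ε < ‖density (ξ t ω) - u t‖ →
      ∀ᶠ r in 𝓝[>] t, ε < ‖density (ξ r ω) - u r‖ := by
  filter_upwards [hξ.right_cont] with ω hω t ht hlt
  have hcont : Tendsto (fun r => ‖density (ξ t ω) - u r‖) (𝓝[>] t) (𝓝 ‖density (ξ t ω) - u t‖) :=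
    (tendsto_const_nhds.sub ((hu.continuousOn t ht).mono
      (Set.Ioi_subset_Ici_self.trans (Set.Ici_subset_Ici.2 ht)))).norm
  filter_upwards [hω t ht, hcont.eventually_const_lt hlt] with r hr hlt'
  rwa [hr]

theorem measure_exists_lt_le [NeZero N] [IsProbabilityMeasure P]
    (hξ : IsLocalDensityProcess P Q d a ξ) (ha : Measurable a) (hD : IsClosed D)
    (hb : RateBounds Q D L B) (hQ : IsRateFunction Q)
    (hQlip : ∀ k s, LocallyLipschitz fun φ => Q φ k s) (hu : IsMeanFieldSolution Q u)
    (hr : 0 ≤ r) (hT : 0 < T) (hδ : 0 < δ) :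
    P {ω | IsWellMixed D d r (a ω) ∧ ‖density (ξ 0 ω) - u 0‖ ≤ δ ∧ ∃ t ∈ Set.Icc 0 T,
        (2 * δ + T * (2 * (S * L * r + (N : ℝ)⁻¹))) * Real.exp (S * (L + B) * T) <
          ‖density (ξ t ω) - u t‖} ≤
      S * ENNReal.ofReal (T * (S * (B + L * r) / N + (N : ℝ)⁻¹) / δ ^ 2) := by
  have hN : 0 < (N : ℝ)⁻¹ := inv_pos.2 (Nat.cast_pos.2 (NeZero.pos N))
  have hmesh : Tendsto (fun m : ℕ => T / (2 : ℝ) ^ m) atTop (𝓝[>] 0) :=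
    tendsto_nhdsWithin_of_tendsto_nhds_of_eventually_within _
      ((tendsto_pow_atTop_atTop_of_one_lt one_lt_two).const_div_atTop T)
      (Eventually.of_forall fun m => Set.mem_Ioi.2 (by positivity))
  have hstep : ∀ᶠ h : ℝ in 𝓝[>] 0, S * (L + B) * (S * B) * h ≤ (N : ℝ)⁻¹ := by
    have hlim : Tendsto (fun h : ℝ => S * (L + B) * (S * B) * h) (𝓝 0) (𝓝 0) :=
      (continuous_const_mul _).tendsto' 0 0 (mul_zero _)
    exact nhdsWithin_le_nhds (hlim.eventually_le_const hN)
  have hEuler := eventually_isEulerStep (n := Config N S) (B := N * (B + L * r)) (by positivity) hN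
  have hmain := measure_exists_mem_Icc_le_of_dyadic (P := P) (T := T)
    (p := fun t ω => (IsWellMixed D d r (a ω) ∧ ‖density (ξ 0 ω) - u 0‖ ≤ δ) ∧
      (2 * δ + T * (2 * (S * L * r + (N : ℝ)⁻¹))) * Real.exp (S * (L + B) * T) <
        ‖density (ξ t ω) - u t‖)
    (c := S * ENNReal.ofReal (T * (S * (B + L * r) / N + (N : ℝ)⁻¹) / δ ^ 2)) hT ?_ ?_
  · refine (measure_mono ?_).trans hmain
    exact fun ω ⟨hmix, h0, t, ht, hlt⟩ => ⟨t, ht, ⟨hmix, h0⟩, hlt⟩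
  · filter_upwards [hξ.ae_eventually_lt_norm_density_sub hu] with ω hω t ht ⟨hgood, hlt⟩
    exact (hω t ht hlt).mono fun r hr => ⟨hgood, hr⟩
  · filter_upwards [hmesh.eventually hstep, hmesh.eventually hEuler] with m hm hm'
    have hgrid := hξ.measure_exists_grid_lt_le ha (isClosed_setOf_isWellMixed hD d r).measurableSet
      (fun _ h => h) hb hQ hQlip hu (fun a' h => hm' _ (h.abs_generator_le hb))
      (by positivity) hr hm (2 ^ m) hδ
    have hTm : ((2 ^ m : ℕ) : ℝ) * (T / 2 ^ m) = T := by
      push_cast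
      field_simp
    simp only [← mul_assoc, hTm] at hgrid
    simp only [← mul_assoc]
    refine (measure_mono ?_).trans hgrid
    exact fun ω ⟨k, hk, ⟨hmix, h0⟩, hlt⟩ => ⟨hmix, h0, k, hk, hlt⟩

end IsLocalDensityProcess

end ContinuousTime

section InProbability

theorem tendsto_zero_of_eventually_le {f g : ℕ → ℝ≥0∞} (hg : Tendsto g atTop (𝓝 0))
    (hfg : ∀ᶠ N in atTop, f N ≤ g N) : Tendsto f atTop (𝓝 0) :=
  tendsto_of_tendsto_of_tendsto_of_le_of_le' tendsto_const_nhds hg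
    (Eventually.of_forall fun _ => zero_le) hfg

theorem ofReal_norm_sub_le_dist1 {S : ℕ} (x y : Fin S → ℝ) :
    ENNReal.ofReal ‖x - y‖ ≤ dist1 x y := by
  refine ENNReal.ofReal_le_ofReal ((pi_norm_le_iff_of_nonneg (by positivity)).2 fun s => ?_)
  exact Finset.single_le_sum (f := fun s => |x s - y s|) (fun _ _ => abs_nonneg _)
    (Finset.mem_univ s)

theorem dist1_le_ofReal {S : ℕ} {x y : Fin S → ℝ} {r : ℝ} (h : ‖x - y‖ ≤ r) :
    dist1 x y ≤ ENNReal.ofReal (S * r) := by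
  refine ENNReal.ofReal_le_ofReal ?_
  calc ∑ s, |x s - y s| ≤ ∑ _s : Fin S, r :=
        Finset.sum_le_sum fun s _ => (norm_le_pi_norm (x - y) s).trans h
    _ = _ := by simp

theorem exists_lt_norm_of_le_supDist (S : ℕ) {ε : ℝ≥0∞} (hε : 0 < ε) :
    ∃ r > 0, ∀ (T : ℝ) (x y : ℝ → Fin S → ℝ), ε ≤ supDist T x y →
      ∃ t ∈ Set.Icc 0 T, r < ‖x t - y t‖ := by
  have hlim : Tendsto (fun r : ℝ => ENNReal.ofReal (S * r)) (𝓝 0) (𝓝 0) :=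
    (ENNReal.continuous_ofReal.comp (continuous_const_mul _)).tendsto' _ _ (by simp)
  obtain ⟨r, hr, hr0⟩ := ((hlim.mono_left nhdsWithin_le_nhds).eventually_lt_const hε |>.and
    (self_mem_nhdsWithin (s := Set.Ioi 0))).exists
  refine ⟨r, hr0, fun T x y hle => ?_⟩
  by_contra! hclose
  exact (hle.trans (iSup₂_le fun t ht => dist1_le_ofReal (hclose t ht))).not_gt hr

variable {S : ℕ} {Ω : ℕ → Type*} [∀ N, MeasurableSpace (Ω N)] {P : ∀ N, Measure (Ω N)}

theorem TendstoZeroInProbability.tendsto_measure_lt_norm {x : ∀ N, Ω N → Fin S → ℝ}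
    {y : Fin S → ℝ} (h : TendstoZeroInProbability P fun N ω => dist1 (x N ω) y) {δ : ℝ}
    (hδ : 0 < δ) : Tendsto (fun N => P N {ω | δ < ‖x N ω - y‖}) atTop (𝓝 0) :=
  tendsto_zero_of_eventually_le (h _ (ENNReal.ofReal_pos.2 hδ)) (Eventually.of_forall fun _ =>
    measure_mono fun _ hω =>
      (ENNReal.ofReal_le_ofReal (le_of_lt hω)).trans (ofReal_norm_sub_le_dist1 _ _))

theorem tendstoZeroInProbability_supDist {x : ∀ N, Ω N → ℝ → Fin S → ℝ} {u : ℝ → Fin S → ℝ}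
    {T : ℝ} (h : ∀ ε > 0, Tendsto (fun N => P N {ω | ∃ t ∈ Set.Icc 0 T, ε < ‖x N ω t - u t‖})
      atTop (𝓝 0)) :
    TendstoZeroInProbability P fun N ω => supDist T (x N ω) u := fun ε hε => by
  obtain ⟨r, hr, hsup⟩ := exists_lt_norm_of_le_supDist S hε
  exact tendsto_zero_of_eventually_le (h r hr)
    (Eventually.of_forall fun N => measure_mono fun ω hω => hsup T _ _ hω)

end InProbability

section WellMixedSequences

variable {S : ℕ} {Q : (Fin S → ℝ) → Matrix (Fin S) (Fin S) ℝ} {D : Set (Fin S → ℝ)}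
  {L B : NNReal} {u : ℝ → Fin S → ℝ} {T : ℝ} {Ω : ℕ → Type*} [∀ N, MeasurableSpace (Ω N)]
  {P : ∀ N, Measure (Ω N)} {d : ℕ → ℝ} {a : ∀ N, Ω N → Fin N → Fin N → ℝ}

theorem tendstoZeroInProbability_supDist_density [∀ N, IsProbabilityMeasure (P N)]
    {ξ : ∀ N, ℝ → Ω N → Config N S} (hξ : ∀ N, IsLocalDensityProcess (P N) Q (d N) (a N) (ξ N))
    (ha : ∀ N, Measurable (a N)) (hD : IsClosed D) (hb : RateBounds Q D L B)
    (hQ : IsRateFunction Q) (hQlip : ∀ k s, LocallyLipschitz fun φ => Q φ k s)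
    (hu : IsMeanFieldSolution Q u)
    (hmix : ∀ r > 0, Tendsto (fun N => P N {ω | ¬IsWellMixed D (d N) r (a N ω)}) atTop (𝓝 0))
    (hinit : TendstoZeroInProbability P fun N ω => dist1 (density (ξ N 0 ω)) (u 0)) (hT : 0 < T) :
    TendstoZeroInProbability P fun N ω => supDist T (fun t => density (ξ N t ω)) u := by
  refine tendstoZeroInProbability_supDist fun ε hε => ?_
  obtain ⟨r, hr, hrε⟩ := exists_pos_mul_lt hε
    ((2 + T * (2 * (S * L + 1))) * Real.exp (S * (L + B) * T))
  have hrare : Tendsto (fun N : ℕ => (S : ℝ≥0∞) *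
      ENNReal.ofReal (T * (S * (B + L * r) / N + (N : ℝ)⁻¹) / r ^ 2)) atTop (𝓝 0) := by
    have hreal := (((tendsto_const_div_atTop_nhds_zero_nat (S * (B + L * r))).add
      (tendsto_inv_atTop_nhds_zero_nat (𝕜 := ℝ))).const_mul T).div_const (r ^ 2)
    simpa using ENNReal.Tendsto.const_mul (a := (S : ℝ≥0∞)) (ENNReal.tendsto_ofReal hreal)
      (Or.inr (ENNReal.natCast_ne_top S))
  have hsum := ((hmix r hr).add (hinit.tendsto_measure_lt_norm hr)).add hrare
  simp only [add_zero] at hsum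
  refine tendsto_zero_of_eventually_le hsum ?_
  filter_upwards [eventually_ge_atTop 1,
    (tendsto_inv_atTop_nhds_zero_nat (𝕜 := ℝ)).eventually_le_const hr] with N hN hNr
  have : NeZero N := ⟨by omega⟩
  have hthreshold : (2 * r + T * (2 * (S * L * r + (N : ℝ)⁻¹))) * Real.exp (S * (L + B) * T) ≤ ε :=
    calc _ ≤ (2 * r + T * (2 * (S * L * r + r))) * Real.exp (S * (L + B) * T) := by gcongr
      _ = (2 + T * (2 * (S * L + 1))) * Real.exp (S * (L + B) * T) * r := by ring
      _ ≤ ε := hrε.le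
  refine le_trans (measure_mono ?_) ((measure_union_le _ _).trans (add_le_add
    (measure_union_le _ _) ((hξ N).measure_exists_lt_le (ha N) hD hb hQ hQlip hu hr.le hT hr)))
  rintro ω ⟨t, ht, hlt⟩
  by_cases hω : IsWellMixed D (d N) r (a N ω)
  · by_cases h0 : ‖density (ξ N 0 ω) - u 0‖ ≤ r
    · exact Or.inr ⟨hω, h0, t, ht, hthreshold.trans_lt hlt⟩
    · exact Or.inl (Or.inr (not_le.1 h0))
  · exact Or.inl (Or.inl hω)

theorem tendstoZeroInProbability_supDist_average {z : ∀ N, Ω N → ℝ → Fin N → Fin S → ℝ}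
    (hz : ∀ N, ∀ᵐ ω ∂(P N), IsNIMFA Q (d N) (a N ω) (z N ω)) (hd : ∀ᶠ N in atTop, 0 ≤ d N)
    (hb : RateBounds Q D L B) (hQ : IsRateFunction Q)
    (hQlip : ∀ k s, LocallyLipschitz fun φ => Q φ k s) (hu : IsMeanFieldSolution Q u)
    (hmix : ∀ r > 0, Tendsto (fun N => P N {ω | ¬IsWellMixed D (d N) r (a N ω)}) atTop (𝓝 0))
    (hinit : TendstoZeroInProbability P fun N ω => dist1 (average (z N ω 0)) (u 0)) :
    TendstoZeroInProbability P fun N ω => supDist T (fun t => average (z N ω t)) u := by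
  refine tendstoZeroInProbability_supDist fun ε hε => ?_
  obtain ⟨r, hr, hrε⟩ := exists_pos_mul_lt hε ((1 + S * L * T) * Real.exp (S * (L + B) * T))
  have hsum := (hmix r hr).add (hinit.tendsto_measure_lt_norm hr)
  simp only [add_zero] at hsum
  refine tendsto_zero_of_eventually_le hsum ?_
  filter_upwards [eventually_ge_atTop 1, hd] with N hN hdN
  have : NeZero N := ⟨by omega⟩
  refine (measure_mono_ae ?_).trans (measure_union_le _ _)
  filter_upwards [hz N] with ω hzω ⟨t, ht, hlt⟩
  by_cases hω : IsWellMixed D (d N) r (a N ω)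
  · by_cases h0 : ‖average (z N ω 0) - u 0‖ ≤ r
    swap
    · exact Or.inr (not_le.1 h0)
    refine absurd hlt (not_lt.2 ?_)
    calc _ ≤ (r + S * L * r * T) * Real.exp (S * (L + B) * T) :=
          hzω.norm_average_sub_le hQ hQlip hdN hb hω hu h0 ht
      _ = (1 + S * L * T) * Real.exp (S * (L + B) * T) * r := by ring
      _ ≤ ε := hrε.le
  · exact Or.inl hω

end WellMixedSequences

section ErdosRenyi

variable {p : ℕ → ℝ}

theorem tendsto_mul_sq_of_avgDegree (hp : ∀ N, 0 ≤ p N) {μ c ε : ℝ} (hμ : 0 < μ) (hc : 0 < c)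
    (hε : 0 < ε)
    (h : ∀ᶠ N : ℕ in atTop, c * (N : ℝ) ^ ((1 : ℝ) / 2 + ε) ≤ avgDegree N (p N) μ) :
    Tendsto (fun N : ℕ => (N : ℝ) * p N ^ 2) atTop atTop := by
  have hlim : Tendsto (fun N : ℕ => (c / μ) ^ 2 * (N : ℝ) ^ (2 * ε)) atTop atTop :=
    ((tendsto_rpow_atTop (by positivity)).comp tendsto_natCast_atTop_atTop).const_mul_atTop
      (by positivity)
  refine tendsto_atTop_mono' _ ?_ hlim
  filter_upwards [h, eventually_gt_atTop 0] with N hN hN0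
  have hN0 : (0 : ℝ) < N := Nat.cast_pos.2 hN0
  have hdeg : c * (N : ℝ) ^ ((1 : ℝ) / 2 + ε) ≤ N * (p N * μ) := by
    refine hN.trans (mul_le_mul_of_nonneg_right (sub_le_self _ zero_le_one) ?_)
    exact mul_nonneg (hp N) hμ.le
  have hpow : ((N : ℝ) ^ ((1 : ℝ) / 2 + ε)) ^ 2 = N * (N : ℝ) ^ (2 * ε) := by
    rw [← Real.rpow_natCast, ← Real.rpow_mul hN0.le, ← Real.rpow_one_add' hN0.le (by positivity)]
    ring_nf
  rw [← mul_le_mul_iff_of_pos_left (by positivity : 0 < N * μ ^ 2)]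
  calc N * μ ^ 2 * ((c / μ) ^ 2 * (N : ℝ) ^ (2 * ε)) = (c * (N : ℝ) ^ ((1 : ℝ) / 2 + ε)) ^ 2 := by
        rw [mul_pow, hpow]
        field_simp
    _ ≤ (N * (p N * μ)) ^ 2 := by gcongr
    _ = _ := by ring

theorem tendsto_mul_of_tendsto_mul_sq (hp01 : ∀ N, p N ∈ Set.Icc (0 : ℝ) 1)
    (hp : Tendsto (fun N : ℕ => (N : ℝ) * p N ^ 2) atTop atTop) :
    Tendsto (fun N : ℕ => (N : ℝ) * p N) atTop atTop :=
  tendsto_atTop_mono (fun N => mul_le_mul_of_nonneg_left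
    (pow_le_of_le_one (hp01 N).1 (hp01 N).2 two_ne_zero) N.cast_nonneg) hp

theorem tendsto_mul_exp_neg_of_tendsto_mul_sq (hp01 : ∀ N, p N ∈ Set.Icc (0 : ℝ) 1)
    (hp : Tendsto (fun N : ℕ => (N : ℝ) * p N ^ 2) atTop atTop) :
    Tendsto (fun N : ℕ => (N : ℝ) * Real.exp (-((N - 1) * p N))) atTop (𝓝 0) := by
  have hlim : Tendsto (fun N : ℕ => (N * p N) ^ 2 * Real.exp (-(N * p N)) * Real.exp 1) atTop
      (𝓝 0) := by
    simpa using ((Real.tendsto_pow_mul_exp_neg_atTop_nhds_zero 2).comp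
      (tendsto_mul_of_tendsto_mul_sq hp01 hp)).mul_const (Real.exp 1)
  refine squeeze_zero' (Eventually.of_forall fun N => by positivity) ?_ hlim
  filter_upwards [hp.eventually_ge_atTop 1] with N hN
  have hsq : (N : ℝ) ≤ (N * p N) ^ 2 := by
    calc (N : ℝ) ≤ N * (N * p N ^ 2) := le_mul_of_one_le_right N.cast_nonneg hN
      _ = _ := by ring
  rw [mul_assoc, ← Real.exp_add]
  gcongr
  linarith [(hp01 N).2]

variable {S : ℕ} {D : Set (Fin S → ℝ)} {ν : Measure ℝ} {Ω : ℕ → Type*}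
  [∀ N, MeasurableSpace (Ω N)] {P : ∀ N, Measure (Ω N)} {w b : ∀ N, Edge N → Ω N → ℝ}

theorem tendsto_measure_not_hasSmallGram [IsFiniteMeasure ν]
    (hG : ∀ N, IsWeightedErdosRenyi (P N) ν (p N) (w N) (b N)) (hν : MemLp id 2 ν)
    (hμ : ∫ x, x ∂ν ≠ 0) (hp : Tendsto (fun N : ℕ => (N : ℝ) * p N ^ 2) atTop atTop) {κ : ℝ}
    (hκ : 0 < κ) :
    Tendsto (fun N => P N {ω | ¬HasSmallGram κ (centered (avgDegree N (p N) (∫ x, x ∂ν))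
      (adj (fun e => w N e ω) fun e => b N e ω))}) atTop (𝓝 0) := by
  have hp1 := tendsto_mul_of_tendsto_mul_sq (fun N => (hG N).p_mem) hp
  set c := 4 * (∫ x, x ^ 2 ∂ν) / (∫ x, x ∂ν) ^ 2
  have hsum := (ENNReal.tendsto_ofReal ((hp1.const_div_atTop c).div_const κ)).add
    (ENNReal.tendsto_ofReal ((hp.const_div_atTop (c ^ 2)).div_const (κ ^ 2)))
  simp only [zero_div, ENNReal.ofReal_zero, add_zero] at hsum
  refine tendsto_zero_of_eventually_le hsum ?_
  filter_upwards [eventually_gt_atTop 1, hp1.eventually_gt_atTop 0] with N hN hpN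
  exact (hG N).measure_not_hasSmallGram_le hν hμ (right_ne_zero_of_mul hpN.ne') hN hκ

theorem tendsto_measure_not_environment_mem_Icc
    (hG : ∀ N, IsWeightedErdosRenyi (P N) ν (p N) (w N) (b N)) (hν : ∀ᵐ x ∂ν, 0 ≤ x)
    (hμ : 0 < ∫ x, x ∂ν) (hp : Tendsto (fun N : ℕ => (N : ℝ) * p N ^ 2) atTop atTop) {θ K : ℝ}
    (hθ : 0 < θ) (hexp : Integrable (fun x => Real.exp (θ * x)) ν)
    (hK : (∫ x, Real.exp (θ * x) ∂ν) / (θ * ∫ x, x ∂ν) ≤ K) :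
    Tendsto (fun N => P N {ω | ¬∀ v : Fin N → Fin S → ℝ, (∀ i, v i ∈ stdSimplex ℝ (Fin S)) →
      ∀ i, environment (avgDegree N (p N) (∫ x, x ∂ν)) (adj (fun e => w N e ω) fun e => b N e ω) v i
        ∈ Set.Icc (0 : Fin S → ℝ) (fun _ => K)}) atTop (𝓝 0) := by
  have hp01 := fun N => (hG N).p_mem
  have hlim := ENNReal.tendsto_ofReal (tendsto_mul_exp_neg_of_tendsto_mul_sq hp01 hp)
  rw [ENNReal.ofReal_zero] at hlim
  refine tendsto_zero_of_eventually_le hlim ?_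
  filter_upwards [eventually_gt_atTop 1,
    (tendsto_mul_of_tendsto_mul_sq hp01 hp).eventually_gt_atTop 0] with N hN hpN
  refine (measure_mono_ae ?_).trans ((hG N).measure_exists_degree_ge_le hμ.ne' hθ hexp hN.le)
  filter_upwards [(hG N).ae_mul_nonneg hν] with ω hnonneg hescape
  have hd : 0 < avgDegree N (p N) (∫ x, x ∂ν) :=
    mul_pos (sub_pos.2 (Nat.one_lt_cast.2 hN))
      (mul_pos (pos_of_mul_pos_right hpN N.cast_nonneg) hμ)
  by_contra hdeg
  refine hescape fun v hv => environment_mem_Icc hd ?_ (fun i => ?_) hv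
  · rw [adj_eq_symmMatrix]
    exact symmMatrix_nonneg hnonneg
  · refine le_of_not_ge fun hi => hdeg ⟨i, le_trans ?_ hi⟩
    gcongr

theorem exists_environment_domain {Q : (Fin S → ℝ) → Matrix (Fin S) (Fin S) ℝ}
    (hQlip : ∀ k s, LocallyLipschitz fun φ => Q φ k s)
    (hG : ∀ N, IsWeightedErdosRenyi (P N) ν (p N) (w N) (b N)) (hν : ∀ᵐ x ∂ν, 0 ≤ x)
    (hμ : 0 < ∫ x, x ∂ν) (hp : Tendsto (fun N : ℕ => (N : ℝ) * p N ^ 2) atTop atTop)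
    (hlip : (∀ k s, ∃ L, LipschitzWith L fun φ => Q φ k s) ∨
      ∃ θ > 0, Integrable (fun x => Real.exp (θ * x)) ν) :
    ∃ D : Set (Fin S → ℝ), IsClosed D ∧ stdSimplex ℝ (Fin S) ⊆ D ∧
      (∀ k s, ∃ L, LipschitzOnWith L (fun φ => Q φ k s) D) ∧
      Tendsto (fun N => P N {ω | ¬∀ v : Fin N → Fin S → ℝ, (∀ i, v i ∈ stdSimplex ℝ (Fin S)) →
        ∀ i, environment (avgDegree N (p N) (∫ x, x ∂ν))
          (adj (fun e => w N e ω) fun e => b N e ω) v i ∈ D}) atTop (𝓝 0) := by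
  rcases hlip with hlip | ⟨θ, hθ, hexp⟩
  · exact ⟨Set.univ, isClosed_univ, Set.subset_univ _,
      fun k s => (hlip k s).imp fun _ h => h.lipschitzOnWith, by simp⟩
  · set K := max 1 ((∫ x, Real.exp (θ * x) ∂ν) / (θ * ∫ x, x ∂ν))
    refine ⟨Set.Icc 0 fun _ => K, isClosed_Icc, fun v hv => ⟨hv.1, fun s => ?_⟩,
      fun k s => (hQlip k s).locallyLipschitzOn.exists_lipschitzOnWith_of_compact isCompact_Icc,
      tendsto_measure_not_environment_mem_Icc hG hν hμ hp hθ hexp (le_max_right _ _)⟩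
    exact (le_of_abs_le (abs_le_one_of_mem_stdSimplex hv s)).trans (le_max_left _ _)

theorem tendsto_measure_not_isWellMixed [IsFiniteMeasure ν]
    (hG : ∀ N, IsWeightedErdosRenyi (P N) ν (p N) (w N) (b N)) (hν_nonneg : ∀ᵐ x ∂ν, 0 ≤ x)
    (hν : MemLp id 2 ν) (hμ : ∫ x, x ∂ν ≠ 0)
    (hp : Tendsto (fun N : ℕ => (N : ℝ) * p N ^ 2) atTop atTop)
    (hD : Tendsto (fun N => P N {ω | ¬∀ v : Fin N → Fin S → ℝ,
      (∀ i, v i ∈ stdSimplex ℝ (Fin S)) → ∀ i, environment (avgDegree N (p N) (∫ x, x ∂ν))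
        (adj (fun e => w N e ω) fun e => b N e ω) v i ∈ D}) atTop (𝓝 0))
    {r : ℝ} (hr : 0 < r) :
    Tendsto (fun N => P N {ω | ¬IsWellMixed D (avgDegree N (p N) (∫ x, x ∂ν)) r
      (adj (fun e => w N e ω) fun e => b N e ω)}) atTop (𝓝 0) := by
  obtain ⟨δ, hδ, hδr⟩ := exists_pos_mul_lt hr S
  have hsqrt : √(2 * (δ ^ 2 / 2)) = δ := by rw [mul_div_cancel₀ _ two_ne_zero, Real.sqrt_sq hδ.le]
  have hradius : Tendsto (fun N : ℕ => S * (δ + 2 / ((N : ℝ) - 1))) atTop (𝓝 (S * (δ + 0))) :=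
    (((tendsto_atTop_add_const_right _ (-1) tendsto_natCast_atTop_atTop).const_div_atTop
      2).const_add δ).const_mul _
  have hsum := hD.add
    (tendsto_measure_not_hasSmallGram hG hν hμ hp (κ := δ ^ 2 / 2) (by positivity))
  rw [add_zero] at hsum hradius
  refine tendsto_zero_of_eventually_le hsum ?_
  filter_upwards [eventually_gt_atTop 1, hradius.eventually_lt_const hδr] with N hN hNr
  refine (measure_mono_ae ?_).trans (measure_union_le _ _)
  filter_upwards [(hG N).ae_mul_nonneg hν_nonneg] with ω hnonneg hω
  by_contra hgood
  obtain ⟨henv, hgram⟩ := not_or.1 hgood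
  refine hω ⟨?_, not_not.1 henv, fun v hv => ?_⟩
  · rw [adj_eq_symmMatrix]
    exact symmMatrix_nonneg hnonneg
  · have hdev := (not_not.1 hgram).deviation_le (by positivity)
      (fun i => by rw [adj_eq_symmMatrix, symmMatrix_self]) hN hv
    rw [hsqrt] at hdev
    exact hdev.trans hNr.le

end ErdosRenyi

end MeanField

theorem theorem2_general {S : ℕ}
    (Q : (Fin S → ℝ) → Matrix (Fin S) (Fin S) ℝ) (hQ : IsRateFunction Q)
    (hQlip : ∀ k s, LocallyLipschitz fun φ => Q φ k s)
    (ν : Measure ℝ) [IsProbabilityMeasure ν] (hν_nonneg : ∀ᵐ x ∂ν, 0 ≤ x)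
    (hν_memLp : MemLp id 2 ν) (hν_pos : 0 < ∫ x, x ∂ν)
    (p : ℕ → ℝ) {Ω : ℕ → Type*} [∀ N, MeasurableSpace (Ω N)] (P : ∀ N, Measure (Ω N))
    [∀ N, IsProbabilityMeasure (P N)] (w b : ∀ N, Edge N → Ω N → ℝ)
    (hG : ∀ N, IsWeightedErdosRenyi (P N) ν (p N) (w N) (b N))
    (ξ : ∀ N, ℝ → Ω N → Config N S)
    (hξ : ∀ N, IsLocalDensityProcess (P N) Q (avgDegree N (p N) (∫ x, x ∂ν))
      (fun ω => adj (fun e => w N e ω) (fun e => b N e ω)) (ξ N))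
    (z : ∀ N, Ω N → ℝ → Fin N → Fin S → ℝ)
    (hz : ∀ N, ∀ᵐ ω ∂(P N), IsNIMFA Q (avgDegree N (p N) (∫ x, x ∂ν))
      (adj (fun e => w N e ω) (fun e => b N e ω)) (z N ω))
    (u : ℝ → Fin S → ℝ) (hu : IsMeanFieldSolution Q u)
    (hx0 : TendstoZeroInProbability P fun N ω => dist1 (average (indicators (ξ N 0 ω))) (u 0))
    (hy0 : TendstoZeroInProbability P fun N ω => dist1 (average (z N ω 0)) (u 0))
    (hp : Tendsto (fun N : ℕ => (N : ℝ) * p N ^ 2) atTop atTop)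
    (hlip : (∀ k s, ∃ L, LipschitzWith L fun φ => Q φ k s) ∨
      ∃ θ > 0, Integrable (fun x => Real.exp (θ * x)) ν) :
    ∀ T > 0,
      TendstoZeroInProbability P
        (fun N ω => supDist T (fun t => average (indicators (ξ N t ω))) u) ∧
      TendstoZeroInProbability P
        (fun N ω => supDist T (fun t => average (z N ω t)) u) := by
  obtain ⟨D, hD, hsimplex, hlipD, henv⟩ :=
    exists_environment_domain hQlip hG hν_nonneg hν_pos hp hlip
  obtain ⟨L, B, hb⟩ := exists_rateBounds hQlip hsimplex hlipD
  have hmix := fun r (hr : 0 < r) =>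
    tendsto_measure_not_isWellMixed hG hν_nonneg hν_memLp hν_pos.ne' hp henv hr
  have hdeg : ∀ᶠ N in atTop, 0 ≤ avgDegree N (p N) (∫ x, x ∂ν) := by
    filter_upwards [eventually_ge_atTop 1] with N hN
    exact mul_nonneg (sub_nonneg.2 (Nat.one_le_cast.2 hN))
      (mul_nonneg (hG N).p_mem.1 hν_pos.le)
  exact fun T hT =>
    ⟨tendstoZeroInProbability_supDist_density hξ (fun N => (hG N).measurable_adj) hD hb hQ hQlip
      hu hmix hx0 hT, tendstoZeroInProbability_supDist_average hz hdeg hb hQ hQlip hu hmix hy0⟩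

theorem theorem2 {S : ℕ}
    -- the rate functions, locally Lipschitz
    (Q : (Fin S → ℝ) → Matrix (Fin S) (Fin S) ℝ) (hQ : IsRateFunction Q)
    (hQlip : ∀ k s, LocallyLipschitz fun φ => Q φ k s)
    -- the law of the weights: nonnegative, with positive finite mean and finite variance
    (ν : Measure ℝ) [IsProbabilityMeasure ν] (hν_nonneg : ∀ᵐ x ∂ν, 0 ≤ x)
    (hν_memLp : MemLp id 2 ν) (hν_pos : 0 < ∫ x, x ∂ν)
    -- the weighted Erdős–Rényi graphs
    (p : ℕ → ℝ) {Ω : ℕ → Type*} [∀ N, MeasurableSpace (Ω N)] (P : ∀ N, Measure (Ω N))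
    [∀ N, IsProbabilityMeasure (P N)] (w b : ∀ N, Edge N → Ω N → ℝ)
    (hG : ∀ N, IsWeightedErdosRenyi (P N) ν (p N) (w N) (b N))
    -- the local density-dependent Markov processes on them
    (ξ : ∀ N, ℝ → Ω N → Config N S)
    (hξ : ∀ N, IsLocalDensityProcess (P N) Q (avgDegree N (p N) (∫ x, x ∂ν))
      (fun ω => adj (fun e => w N e ω) (fun e => b N e ω)) (ξ N))
    -- the NIMFA approximations
    (z : ∀ N, Ω N → ℝ → Fin N → Fin S → ℝ)
    (hz : ∀ N, ∀ᵐ ω ∂(P N), IsNIMFA Q (avgDegree N (p N) (∫ x, x ∂ν))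
      (adj (fun e => w N e ω) (fun e => b N e ω)) (z N ω))
    -- the homogeneous mean-field approximation
    (u : ℝ → Fin S → ℝ) (hu : IsMeanFieldSolution Q u)
    -- convergence of the initial conditions
    (hx0 : TendstoZeroInProbability P fun N ω => dist1 (average (indicators (ξ N 0 ω))) (u 0))
    (hy0 : TendstoZeroInProbability P fun N ω => dist1 (average (z N ω 0)) (u 0))
    -- either (A1 and A2) or (B1 and B2)
    (hAB :
      ((∀ k s, ∃ L, LipschitzWith L fun φ => Q φ k s) ∧
        ∃ c > 0, ∃ ε > 0, ∀ᶠ N : ℕ in atTop,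
          c * (N : ℝ) ^ ((1 : ℝ) / 2 + ε) ≤ avgDegree N (p N) (∫ x, x ∂ν)) ∨
      ((∀ N, p N = 1) ∧ ∃ θ > 0, Integrable (fun x => Real.exp (θ * x)) ν)) :
    ∀ T > 0,
      TendstoZeroInProbability P
        (fun N ω => supDist T (fun t => average (indicators (ξ N t ω))) u) ∧
      TendstoZeroInProbability P
        (fun N ω => supDist T (fun t => average (z N ω t)) u) := by
  rcases hAB with ⟨hlip, c, hc, ε, hε, hdeg⟩ | ⟨hp1, hexp⟩
  · exact theorem2_general Q hQ hQlip ν hν_nonneg hν_memLp hν_pos p P w b hG ξ hξ z hz u hu hx0 hy0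
      (tendsto_mul_sq_of_avgDegree (fun N => (hG N).p_mem.1) hν_pos hc hε hdeg) (Or.inl hlip)
  · exact theorem2_general Q hQ hQlip ν hν_nonneg hν_memLp hν_pos p P w b hG ξ hξ z hz u hu hx0 hy0
      (by simpa [hp1] using tendsto_natCast_atTop_atTop) (Or.inr hexp)
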